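/- Let $(M,g)$ be a connected, complete, finite-dimensional smooth Riemannian manifold (without boundary). A \emph{length minimizing geodesic} from $x$ to $y$ is a geodesic $\gamma:[0,1]\to M$ of the Levi-Civita connection with $\gamma(0)=x$, $\gamma(1)=y$ whose length is the Riemannian distance from $x$ to $y$ (constant geodesics are allowed when $x=y$). A subset $A\subseteq M$ is \emph{geodesically convex} if for all $x,y\in A$ there is a length minimizing geodesic from $x$ to $y$ contained in $A$. For $p,x\in M$ let $G_p^x\subseteq T_pM$ be the set of the initial velocities $\gamma'(0)$ of all length minimizing geodesics $\gamma$ from $p$ to $x$. A \emph{direction function} at $p$ is a map $\eta_p:M\to T_pM$ with $\eta_p(x)\in G_p^x$ for all $x\in M$. For $\lambda\in(0,1]$ and $x\in M$ put $\eta_pC^\lambda(x)=\gamma(\lambda)$, where $\gamma$ is the length minimizing geodesic from $p$ to $x$ with $\gamma'(0)=\eta_p(x)$. A nonempty set $A\subseteq M$ is \emph{$p^\lambda$-convex with respect to $\eta_p$} if for all $x,y\in A$ there is a length minimizing geodesic from $\eta_pC^\lambda(x)$ to $\eta_pC^\lambda(y)$ contained in $A$. A nonempty set $A$ is \emph{totally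 $p$-convex} if there is a direction function $\eta_p$ at $p$ such that $A$ is $p^\lambda$-convex with respect to $\eta_p$ for every $\lambda\in(0,1]$. Then for every subset $A$ of $M$ containing more than two points the following are equivalent: (1) $A$ is geodesically convex; (2) $A$ is totally $p$-convex for every $p\in A$. -/

import Mathlib

open Set Manifold Bundle
open scoped ContDiff

noncomputable section

namespace RadialConvexity

section Geodesics

variable {E : Type*} [NormedAddCommGroup E] [NormedSpace ℝ E]
  {M : Type*} [TopologicalSpace M] [ChartedSpace E M]
  [RiemannianBundle (fun x : M => TangentSpace 𝓘(ℝ, E) x)]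

/-- The coefficients `g_y(v, w)` of the Riemannian metric, read at the point `y : E` of the chart
around `x₀`: the inner product of the tangent vectors of `M` whose coordinates are `v` and `w`. -/
def chartMetric (x₀ : M) (y v w : E) : ℝ :=
  inner ℝ
    (mfderiv 𝓘(ℝ, E) 𝓘(ℝ, E) (extChartAt 𝓘(ℝ, E) x₀).symm y v :
      TangentSpace 𝓘(ℝ, E) ((extChartAt 𝓘(ℝ, E) x₀).symm y))
    (mfderiv 𝓘(ℝ, E) 𝓘(ℝ, E) (extChartAt 𝓘(ℝ, E) x₀).symm y w)

/-- The Christoffel symbols (of the first kind) of the Levi-Civita connection in the chart around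
`x₀`: `g(∇_v w, z) = (∂_v g(w, z) + ∂_w g(v, z) - ∂_z g(v, w)) / 2` for the vector fields with
constant coordinates `v`, `w`, `z`. -/
def chartChristoffel (x₀ : M) (y v w z : E) : ℝ :=
  (fderiv ℝ (fun y' => chartMetric x₀ y' w z) y v
    + fderiv ℝ (fun y' => chartMetric x₀ y' v z) y w
    - fderiv ℝ (fun y' => chartMetric x₀ y' v w) y z) / 2

/-- `γ`, restricted to `[0,1]`, is a geodesic: it is of class `C²` and `∇_{γ'} γ' = 0` for the
Levi-Civita connection `∇`. The equation is written in coordinates `u` of each chart around `γ t`,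
paired with an arbitrary vector `z`: `g(u'', z) + g(Γ(u', u'), z) = 0`.
The values of `γ` outside `[0,1]` are irrelevant. -/
structure IsGeodesic (γ : ℝ → M) : Prop where
  contMDiffOn : ContMDiffOn 𝓘(ℝ, ℝ) 𝓘(ℝ, E) 2 γ (Icc 0 1)
  geodesic_eq : ∀ (x₀ : M) (u : ℝ → E), u = (fun s => extChartAt 𝓘(ℝ, E) x₀ (γ s)) →
    ∀ t ∈ Icc (0 : ℝ) 1, γ t ∈ (extChartAt 𝓘(ℝ, E) x₀).source → ∀ z : E,
      chartMetric x₀ (u t) (derivWithin (derivWithin u (Icc 0 1)) (Icc 0 1) t) z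
        + chartChristoffel x₀ (u t) (derivWithin u (Icc 0 1) t) (derivWithin u (Icc 0 1) t) z = 0

/-- `γ : [0,1] → M` is a length minimizing geodesic from `x` to `y`: its length is the infimum of
the lengths of the `C¹` curves from `x` to `y`. -/
structure IsMinGeodesic (γ : ℝ → M) (x y : M) : Prop where
  isGeodesic : IsGeodesic (E := E) γ
  source : γ 0 = x
  target : γ 1 = y
  length_eq : pathELength 𝓘(ℝ, E) γ 0 1 = riemannianEDist 𝓘(ℝ, E) x y

/-- `A` is geodesically convex: any two of its points are joined by a length minimizing geodesic
contained in `A`. -/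
def GeodesicallyConvex (E : Type*) [NormedAddCommGroup E] [NormedSpace ℝ E]
    {M : Type*} [TopologicalSpace M] [ChartedSpace E M]
    [RiemannianBundle (fun x : M => TangentSpace 𝓘(ℝ, E) x)] (A : Set M) : Prop :=
  ∀ x ∈ A, ∀ y ∈ A, ∃ γ : ℝ → M, IsMinGeodesic (E := E) γ x y ∧ ∀ t ∈ Icc (0 : ℝ) 1, γ t ∈ A

/-- The set `G_p^x ⊆ T_p M` of the initial velocities `γ'(0)` of the length minimizing geodesics
`γ : [0,1] → M` from `p` to `x`. -/
def initialVelocities (p x : M) : Set (TangentSpace 𝓘(ℝ, E) p) :=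
  {v | ∃ γ : ℝ → M, IsMinGeodesic (E := E) γ p x ∧
    (⟨γ 0, mfderivWithin 𝓘(ℝ, ℝ) 𝓘(ℝ, E) γ (Icc 0 1) 0 (1 : ℝ)⟩ : TangentBundle 𝓘(ℝ, E) M)
      = ⟨p, v⟩}

/-- A direction function at `p`: a map `η : M → T_p M` with `η x ∈ G_p^x` for every `x : M`. -/
structure DirectionFunction (E : Type*) [NormedAddCommGroup E] [NormedSpace ℝ E]
    {M : Type*} [TopologicalSpace M] [ChartedSpace E M]
    [RiemannianBundle (fun x : M => TangentSpace 𝓘(ℝ, E) x)] (p : M) where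
  toFun : M → TangentSpace 𝓘(ℝ, E) p
  mem : ∀ x : M, toFun x ∈ initialVelocities (E := E) p x

/-- The `r`-radial contraction based at `p` with respect to `η`: it maps `x` to `γ r`, where
`γ : [0,1] → M` is the length minimizing geodesic from `p` to `x` with `γ'(0) = η x`
(a geodesic is determined by its initial velocity). -/
def radialContraction {p : M} (η : DirectionFunction E p) (r : ℝ) (x : M) : M :=
  (η.mem x).choose r

/-- `A` is `p^r`-convex with respect to `η`: it is nonempty, and for all `x, y ∈ A` there is a
length minimizing geodesic in `A` which joins the `r`-radial contractions of `x` and `y`. -/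
def IsRadiallyConvex {p : M} (η : DirectionFunction E p) (r : ℝ) (A : Set M) : Prop :=
  A.Nonempty ∧ ∀ x ∈ A, ∀ y ∈ A, ∃ γ : ℝ → M,
    IsMinGeodesic (E := E) γ (radialContraction η r x) (radialContraction η r y) ∧
      ∀ t ∈ Icc (0 : ℝ) 1, γ t ∈ A

/-- `A` is totally `p`-convex: for some direction function at `p`, it is `p^r`-convex for every
`r ∈ (0,1]`. -/
def TotallyConvexAt (E : Type*) [NormedAddCommGroup E] [NormedSpace ℝ E]
    {M : Type*} [TopologicalSpace M] [ChartedSpace E M]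
    [RiemannianBundle (fun x : M => TangentSpace 𝓘(ℝ, E) x)] (p : M) (A : Set M) : Prop :=
  A.Nonempty ∧ ∃ η : DirectionFunction E p, ∀ r ∈ Ioc (0 : ℝ) 1, IsRadiallyConvex η r A

end Geodesics

end RadialConvexity

end

/-! From (2) to (1), take `p = x` and `r = 1`: the contraction with parameter `1` is the identity,
so `p^1`-convexity already supplies a minimizing geodesic in `A` from `x` to `y`. From (1) to (2),
fix `p ∈ A`. For each `x ∈ A` let `η x` be the initial velocity of a minimizing geodesic from `p` to
`x` that stays in `A`; for other `x`, of any minimizing geodesic. Every contraction of a point of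
`A` then lies on a geodesic inside `A`, and geodesic convexity joins any two such contractions
within `A`.

Two facts of Riemannian geometry carry this argument: minimizing geodesics exist between any two
points (Hopf-Rinow, `exists_isMinGeodesic_of_connectedSpace`), and a geodesic is determined by its
initial velocity (`IsGeodesic.eqOn_of_velocity_eq`). The second is needed because a contraction is
defined by some geodesic with velocity `η x`, not by the one chosen in `A`.

Existence is proved metrically. Compactness of small spheres gives a point strictly between any two
distinct points (`exists_between`), and Menger's theorem (`exists_isometric_segment`) then yields a
curve of constant metric speed. In a chart such a curve is Lipschitz, and among curves with the same
endpoints it minimizes the energy: its speed is at most `L`, while any competitor has energy at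
least `L²(b - a)` (`le_integral_energy`). The first variation and the du Bois-Reymond lemma make it
`C²` and a solution of the geodesic equation (`IsMetricOn.contDiffOn_and_geodesic_eq`). Uniqueness
is Picard-Lindelöf for the geodesic vector field in a chart, continued along `[0,1]`. -/

noncomputable section

namespace RadialConvexity

/-! ### Menger's theorem: segments in complete, Menger convex metric spaces. -/

section Menger

variable {X : Type*} [MetricSpace X]

/-- A subset of `X` which contains `p` and `q` and lies on a segment from `p` to `q`, in the sense
that the distance to `p` is isometric on it. -/
structure IsSegmentPart (p q : X) (C : Set X) : Prop where
  left_mem : p ∈ C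
  right_mem : q ∈ C
  dist_eq : ∀ x ∈ C, ∀ y ∈ C, dist x y = |dist p x - dist p y|
  dist_le : ∀ x ∈ C, dist p x ≤ dist p q

lemma isSegmentPart_pair (p q : X) : IsSegmentPart p q {p, q} where
  left_mem := by simp
  right_mem := by simp
  dist_eq := by
    rintro x (rfl | rfl) y (rfl | rfl) <;> simp [dist_comm]
  dist_le := by
    rintro x (rfl | rfl) <;> simp

/-- Each condition concerns at most two points of the set, so it passes to unions of chains and
Zorn's lemma applies. -/
lemma exists_maximal_isSegmentPart (p q : X) : ∃ C, Maximal (IsSegmentPart p q) C := by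
  obtain ⟨C, -, hC⟩ := zorn_subset_nonempty {C | IsSegmentPart p q C} (by
    intro c hc hchain ⟨C₀, hC₀⟩
    refine ⟨⋃₀ c, ⟨?_, ?_, ?_, ?_⟩, fun s hs => subset_sUnion_of_mem hs⟩
    · exact ⟨C₀, hC₀, (hc hC₀).left_mem⟩
    · exact ⟨C₀, hC₀, (hc hC₀).right_mem⟩
    · rintro x ⟨S, hS, hx⟩ y ⟨T, hT, hy⟩
      rcases hchain.total hS hT with h | h
      · exact (hc hT).dist_eq x (h hx) y hy
      · exact (hc hS).dist_eq x hx y (h hy)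
    · rintro x ⟨S, hS, hx⟩
      exact (hc hS).dist_le x hx) {p, q} (isSegmentPart_pair p q)
  exact ⟨C, hC⟩

lemma IsSegmentPart.closure {p q : X} {C : Set X} (h : IsSegmentPart p q C) :
    IsSegmentPart p q (closure C) where
  left_mem := subset_closure h.left_mem
  right_mem := subset_closure h.right_mem
  dist_eq := by
    intro x hx y hy
    have hcl : IsClosed {z : X × X | dist z.1 z.2 = |dist p z.1 - dist p z.2|} :=
      isClosed_eq (by fun_prop) (by fun_prop)
    have : (x, y) ∈ _root_.closure (C ×ˢ C) := by rw [closure_prod_eq]; exact ⟨hx, hy⟩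
    exact closure_minimal (fun z hz => h.dist_eq z.1 hz.1 z.2 hz.2) hcl this
  dist_le := by
    intro x hx
    have hcl : IsClosed {z : X | dist p z ≤ dist p q} := isClosed_le (by fun_prop) (by fun_prop)
    exact closure_minimal (fun z hz => h.dist_le z hz) hcl hx

/-- Maximality forces `C` to be closed, hence complete, and `dist p` is an isometry from `C` into
the line. -/
lemma IsSegmentPart.isClosed_image [CompleteSpace X] {p q : X} {C : Set X}
    (h : Maximal (IsSegmentPart p q) C) : IsClosed (dist p '' C) := by
  have hC : IsClosed C :=
    isClosed_of_closure_subset (h.2 h.1.closure subset_closure)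
  have : CompleteSpace C := hC.completeSpace_coe
  have hiso : Isometry (fun x : C => dist p (x : X)) := by
    refine Isometry.of_dist_eq fun x y => ?_
    rw [Real.dist_eq, Subtype.dist_eq, h.1.dist_eq x x.2 y y.2]
  have := hiso.isClosedEmbedding.isClosed_range
  rwa [show range (fun x : C => dist p (x : X)) = dist p '' C by
    ext; simp] at this

/-- A maximal segment part is the whole segment, if the space is Menger convex. -/
lemma IsSegmentPart.mem_image_of_maximal [CompleteSpace X]
    (hX : ∀ x y : X, x ≠ y → ∃ z, z ≠ x ∧ z ≠ y ∧ dist x z + dist z y = dist x y)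
    {p q : X} {C : Set X} (h : Maximal (IsSegmentPart p q) C) {s : ℝ}
    (hs : s ∈ Icc 0 (dist p q)) : s ∈ dist p '' C := by
  by_contra hsC
  have hcl := IsSegmentPart.isClosed_image h
  -- The missing value `s` lies in a gap of the closed image; `x` and `y` realize the two ends of
  -- this gap. A point `z` between them can be added to `C`, which contradicts maximality.
  obtain ⟨a, ⟨⟨x, hx, rfl⟩, ha0, has⟩, hamax⟩ :=
    (isCompact_Icc.inter_left hcl : IsCompact (dist p '' C ∩ Icc 0 s)).exists_isGreatest
      ⟨0, ⟨p, h.1.left_mem, dist_self p⟩, le_rfl, hs.1⟩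
  obtain ⟨b, ⟨⟨y, hy, rfl⟩, hbs, hbL⟩, hbmin⟩ :=
    (isCompact_Icc.inter_left hcl :
      IsCompact (dist p '' C ∩ Icc s (dist p q))).exists_isLeast
      ⟨dist p q, ⟨q, h.1.right_mem, rfl⟩, hs.2, le_rfl⟩
  have hxs : dist p x < s := lt_of_le_of_ne has fun e => hsC ⟨x, hx, e⟩
  have hys : s < dist p y := lt_of_le_of_ne hbs fun e => hsC ⟨y, hy, e.symm⟩
  have hgap : ∀ w ∈ C, dist p w ≤ dist p x ∨ dist p y ≤ dist p w := by
    intro w hw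
    rcases le_total (dist p w) s with h1 | h1
    · exact Or.inl (hamax ⟨⟨w, hw, rfl⟩, dist_nonneg, h1⟩)
    · exact Or.inr (hbmin ⟨⟨w, hw, rfl⟩, h1, h.1.dist_le w hw⟩)
  have hxy : x ≠ y := by rintro rfl; linarith
  obtain ⟨z, hzx, hzy, hz⟩ := hX x y hxy
  have hxz : 0 < dist x z := dist_pos.2 hzx.symm
  have hzy' : 0 < dist z y := dist_pos.2 hzy
  have hdxy : dist x y = dist p y - dist p x := by
    rw [h.1.dist_eq x hx y hy, abs_sub_comm, abs_of_pos (by linarith)]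
  have hpz : dist p z = dist p x + dist x z := by
    apply le_antisymm (dist_triangle _ _ _)
    linarith [dist_triangle p z y]
  -- Since `w` is not in the gap, the upper bound goes through `x` or `y`, whichever is on the side
  -- of `w`; the lower bound is the triangle inequality with `p`.
  have hwz : ∀ w ∈ C, dist w z = |dist p w - dist p z| := by
    intro w hw
    rcases hgap w hw with h1 | h1
    · rw [abs_sub_comm, abs_of_nonneg (by linarith)]
      have h2 := h.1.dist_eq w hw x hx
      rw [abs_sub_comm, abs_of_nonneg (by linarith)] at h2
      apply le_antisymm
      · linarith [dist_triangle w x z]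
      · linarith [dist_triangle p w z]
    · rw [abs_of_nonneg (by linarith)]
      have h2 := h.1.dist_eq w hw y hy
      rw [abs_of_nonneg (by linarith)] at h2
      apply le_antisymm
      · linarith [dist_triangle w y z, dist_comm y z]
      · linarith [dist_triangle p z w, dist_comm w z]
  have hins : IsSegmentPart p q (insert z C) := by
    refine ⟨Or.inr h.1.left_mem, Or.inr h.1.right_mem, ?_, ?_⟩
    · rintro w (rfl | hw) w' (rfl | hw')
      · simp
      · rw [dist_comm, abs_sub_comm]; exact hwz w' hw'
      · exact hwz w hw
      · exact h.1.dist_eq w hw w' hw'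
    · rintro w (rfl | hw)
      · linarith
      · exact h.1.dist_le w hw
  have hzC : z ∈ C := h.2 hins (subset_insert z C) (mem_insert z C)
  rcases hgap z hzC with h1 | h1 <;> linarith

/-- **Menger's theorem**: a complete metric space in which any two distinct points have a third
point between them is a geodesic space. -/
theorem exists_isometric_segment [CompleteSpace X]
    (hX : ∀ x y : X, x ≠ y → ∃ z, z ≠ x ∧ z ≠ y ∧ dist x z + dist z y = dist x y) (p q : X) :
    ∃ γ : ℝ → X, γ 0 = p ∧ γ 1 = q ∧
      ∀ s ∈ Icc (0 : ℝ) 1, ∀ t ∈ Icc (0 : ℝ) 1, dist (γ s) (γ t) = |s - t| * dist p q := by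
  obtain ⟨C, hC⟩ := exists_maximal_isSegmentPart p q
  have hex : ∀ t : ℝ, ∃ x : X, t ∈ Icc (0 : ℝ) 1 → x ∈ C ∧ dist p x = t * dist p q := by
    intro t
    by_cases ht : t ∈ Icc (0 : ℝ) 1
    · obtain ⟨x, hx, h⟩ := IsSegmentPart.mem_image_of_maximal hX hC (s := t * dist p q)
        ⟨mul_nonneg ht.1 dist_nonneg, mul_le_of_le_one_left dist_nonneg ht.2⟩
      exact ⟨x, fun _ => ⟨hx, h⟩⟩
    · exact ⟨p, fun h => absurd h ht⟩
  choose γ hγ using hex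
  have h0 := hγ 0 (by simp)
  have h1 := hγ 1 (by simp)
  refine ⟨γ, ?_, ?_, ?_⟩
  · exact (dist_eq_zero.1 (by simpa using h0.2)).symm
  · apply dist_eq_zero.1
    rw [hC.1.dist_eq _ h1.1 _ hC.1.right_mem, h1.2]
    simp
  · intro s hs t ht
    rw [hC.1.dist_eq _ (hγ s hs).1 _ (hγ t ht).1, (hγ s hs).2, (hγ t ht).2, ← sub_mul, abs_mul,
      abs_of_nonneg dist_nonneg]

end Menger

end RadialConvexity

end

noncomputable section

namespace RadialConvexity

/-! ### Lipschitz functions as integrals, and the du Bois-Reymond lemma. -/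

section DuBoisReymond

open MeasureTheory
open scoped NNReal Topology

variable {F : Type*} [NormedAddCommGroup F] [NormedSpace ℝ F]

lemma ae_mem_Icc_imp_of_mem_Ioo {a b : ℝ} {P : ℝ → Prop} (h : ∀ t ∈ Ioo a b, P t) :
    ∀ᵐ t, t ∈ Icc a b → P t := by
  have h1 : ∀ᵐ t : ℝ, t ≠ a := by simp [ae_iff, measure_singleton]
  have h2 : ∀ᵐ t : ℝ, t ≠ b := by simp [ae_iff, measure_singleton]
  filter_upwards [h1, h2] with t ha hb ht
  exact h t ⟨lt_of_le_of_ne ht.1 ha.symm, lt_of_le_of_ne ht.2 hb⟩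

lemma ae_differentiableAt_of_lipschitzOnWith [FiniteDimensional ℝ F] {u : ℝ → F} {K : ℝ≥0}
    {a b : ℝ} (hab : a ≤ b) (hu : LipschitzOnWith K u (Icc a b)) :
    ∀ᵐ t, t ∈ Icc a b → DifferentiableAt ℝ u t := by
  rw [← uIcc_of_le hab] at hu ⊢
  exact hu.absolutelyContinuousOnInterval.boundedVariationOn.ae_differentiableAt_of_mem_uIcc

lemma ae_norm_deriv_le_of_lipschitzOnWith {u : ℝ → F} {K : ℝ≥0}
    {a b : ℝ} (hu : LipschitzOnWith K u (Icc a b)) :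
    ∀ᵐ t, t ∈ Icc a b → ‖deriv u t‖ ≤ K :=
  ae_mem_Icc_imp_of_mem_Ioo fun _ ht => norm_deriv_le_of_lipschitzOn (Icc_mem_nhds ht.1 ht.2) hu

omit [NormedSpace ℝ F] in
lemma intervalIntegrable_of_ae_norm_le {f : ℝ → F} {a b C : ℝ} (hab : a ≤ b)
    (hf : AEStronglyMeasurable f (volume.restrict (Icc a b)))
    (hC : ∀ᵐ t, t ∈ Icc a b → ‖f t‖ ≤ C) : IntervalIntegrable f volume a b := by
  rw [intervalIntegrable_iff_integrableOn_Icc_of_le hab]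
  refine Integrable.of_bound hf C ?_
  rwa [ae_restrict_iff' measurableSet_Icc]

lemma lipschitzOnWith_intervalIntegral {f : ℝ → F} {a b : ℝ} {C : ℝ≥0}
    (hf : IntervalIntegrable f volume a b) (hC : ∀ᵐ t, t ∈ Icc a b → ‖f t‖ ≤ C) :
    LipschitzOnWith C (fun t => ∫ s in a..t, f s) (Icc a b) := by
  apply LipschitzOnWith.of_dist_le_mul
  intro s hs t ht
  have hint : ∀ r ∈ Icc a b, IntervalIntegrable f volume a r := fun r hr =>
    hf.mono_set (by rw [uIcc_of_le hr.1, uIcc_of_le (hr.1.trans hr.2)]; exact Icc_subset_Icc_right hr.2)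
  rw [dist_eq_norm, intervalIntegral.integral_interval_sub_left (hint s hs) (hint t ht),
    Real.dist_eq]
  apply intervalIntegral.norm_integral_le_of_norm_le_const_ae
  filter_upwards [hC] with r hr hrm
  apply hr
  rw [uIoc, mem_Ioc] at hrm
  exact ⟨(le_min ht.1 hs.1).trans hrm.1.le, hrm.2.trans (max_le ht.2 hs.2)⟩

lemma hasDerivWithinAt_of_eq_integral [CompleteSpace F] {f u : ℝ → F} {a b : ℝ} (hab : a ≤ b)
    (hf : ContinuousOn f (Icc a b)) {c : F} (hu : ∀ t ∈ Icc a b, u t = c + ∫ s in a..t, f s) {t : ℝ}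
    (ht : t ∈ Icc a b) : HasDerivWithinAt u (f t) (Icc a b) t := by
  -- Extending `f` by its end values makes it continuous on the whole line, so the two-sided
  -- fundamental theorem covers the endpoints as well.
  set g : ℝ → F := fun s => f (projIcc a b hab s) with hg
  have hgc : Continuous g := hf.comp_continuous (by fun_prop) fun s => (projIcc a b hab s).2
  have hgf : ∀ s ∈ Icc a b, g s = f s := fun s hs => by simp [hg, projIcc_of_mem hab hs]
  have h1 : HasDerivAt (fun r => c + ∫ s in a..r, g s) (g t) t :=
    (intervalIntegral.integral_hasDerivAt_right (hgc.intervalIntegrable _ _)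
      (hgc.stronglyMeasurableAtFilter _ _) hgc.continuousAt).const_add c
  rw [← hgf t ht]
  refine h1.hasDerivWithinAt.congr_of_mem (fun r hr => ?_) ht
  rw [hu r hr]
  congr 1
  apply intervalIntegral.integral_congr
  intro s hs
  rw [uIcc_of_le hr.1] at hs
  exact (hgf s ⟨hs.1, hs.2.trans hr.2⟩).symm

/-- The difference of the two sides is absolutely continuous with zero derivative almost everywhere,
hence constant. This upgrades an almost everywhere identity for the derivative to a pointwise one.
-/
lemma eq_integral_of_ae_deriv_eq [CompleteSpace F] [FiniteDimensional ℝ F] {u w : ℝ → F} {K : ℝ≥0}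
    {a b : ℝ} (hab : a ≤ b) (hu : LipschitzOnWith K u (Icc a b)) (hw : ContinuousOn w (Icc a b))
    (h : ∀ᵐ t, t ∈ Icc a b → deriv u t = w t) {t : ℝ} (ht : t ∈ Icc a b) :
    u t = u a + ∫ s in a..t, w s := by
  have hwi : IntervalIntegrable w volume a b := by
    apply ContinuousOn.intervalIntegrable; rwa [uIcc_of_le hab]
  obtain ⟨C, hC⟩ := isCompact_Icc.exists_bound_of_continuousOn hw
  have hIL : LipschitzOnWith C.toNNReal (fun t => ∫ s in a..t, w s) (Icc a b) :=
    lipschitzOnWith_intervalIntegral hwi (.of_forall fun s hs => (hC s hs).trans (Real.le_coe_toNNReal C))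
  have hac : AbsolutelyContinuousOnInterval (u - fun t => ∫ s in a..t, w s) a b := by
    rw [← uIcc_of_le hab] at hu hIL
    exact hu.absolutelyContinuousOnInterval.sub hIL.absolutelyContinuousOnInterval
  obtain ⟨c, hc⟩ := hac.const_of_ae_hasDerivAt_zero (by
    filter_upwards [h, ae_differentiableAt_of_lipschitzOnWith hab hu, hwi.ae_hasDerivAt_integral]
      with s h1 h2 h3 hs
    have h4 := h3 hs a left_mem_uIcc
    rw [uIcc_of_le hab] at hs
    have := (h2 hs).hasDerivAt.sub h4
    rwa [h1 hs, sub_self] at this)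
  have e1 := hc a left_mem_uIcc
  have e2 := hc t (by rwa [uIcc_of_le hab])
  simp only [Pi.sub_apply, intervalIntegral.integral_same, sub_zero] at e1 e2
  rw [e1, ← e2]; abel

/-- The **du Bois-Reymond lemma**. -/
theorem ae_eq_const_add_integral {p f : ℝ → ℝ} {a b : ℝ} {M : ℝ≥0} (hab : a < b)
    (hp : IntervalIntegrable p volume a b) (hpM : ∀ᵐ t, t ∈ Icc a b → ‖p t‖ ≤ M)
    (hf : IntervalIntegrable f volume a b) (hfM : ∀ᵐ t, t ∈ Icc a b → ‖f t‖ ≤ M)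
    (h : ∀ (ψ : ℝ → ℝ) (C : ℝ≥0), LipschitzOnWith C ψ (Icc a b) → ψ a = 0 → ψ b = 0 →
      ∫ t in a..b, (p t * deriv ψ t + f t * ψ t) = 0) :
    ∃ c, ∀ᵐ t, t ∈ Icc a b → p t = c + ∫ s in a..t, f s := by
  set Q : ℝ → ℝ := fun t => ∫ s in a..t, f s with hQ
  have hQL : LipschitzOnWith M Q (Icc a b) := lipschitzOnWith_intervalIntegral hf hfM
  have hIcc : uIcc a b = Icc a b := uIcc_of_le hab.le
  have hQac : AbsolutelyContinuousOnInterval Q a b :=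
    LipschitzOnWith.absolutelyContinuousOnInterval (by rwa [hIcc])
  have hQi : IntervalIntegrable Q volume a b :=
    ContinuousOn.intervalIntegrable (by rw [hIcc]; exact hQL.continuousOn)
  -- The mean is removed so that the primitive `ψ` of `g` vanishes at both ends and is an admissible
  -- test function.
  set m : ℝ := (b - a)⁻¹ * ∫ t in a..b, (p t - Q t) with hm
  set g : ℝ → ℝ := fun t => p t - Q t - m with hg
  have hgi : IntervalIntegrable g volume a b := (hp.sub hQi).sub intervalIntegrable_const
  obtain ⟨C, hC⟩ := isCompact_Icc.exists_bound_of_continuousOn hQL.continuousOn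
  obtain ⟨D, hD⟩ : ∃ D : ℝ≥0, ∀ᵐ t, t ∈ Icc a b → ‖g t‖ ≤ D := by
    refine ⟨M + C.toNNReal + ‖m‖₊, ?_⟩
    filter_upwards [hpM] with t ht htm
    push_cast
    refine (norm_sub_le _ _).trans (add_le_add ((norm_sub_le _ _).trans
      (add_le_add (ht htm) ((hC t htm).trans (Real.le_coe_toNNReal C)))) le_rfl)
  set ψ : ℝ → ℝ := fun t => ∫ s in a..t, g s with hψ
  have hψL : LipschitzOnWith D ψ (Icc a b) := lipschitzOnWith_intervalIntegral hgi hD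
  have hψac : AbsolutelyContinuousOnInterval ψ a b :=
    LipschitzOnWith.absolutelyContinuousOnInterval (by rwa [hIcc])
  have hψi : IntervalIntegrable ψ volume a b :=
    ContinuousOn.intervalIntegrable (by rw [hIcc]; exact hψL.continuousOn)
  have hψa : ψ a = 0 := by simp [hψ]
  have hgint : ∫ t in a..b, g t = 0 := by
    rw [hg, intervalIntegral.integral_sub (hp.sub hQi) intervalIntegrable_const,
      intervalIntegral.integral_const, hm, smul_eq_mul, mul_inv_cancel_left₀ (by linarith), sub_self]
  have hψb : ψ b = 0 := hgint
  have hψd : ∀ᵐ t, t ∈ Icc a b → deriv ψ t = g t := by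
    filter_upwards [hgi.ae_hasDerivAt_integral] with t ht htm
    rw [hIcc] at ht
    exact (ht htm a (left_mem_Icc.2 hab.le)).deriv
  have hQd : ∀ᵐ t, t ∈ Icc a b → deriv Q t = f t := by
    filter_upwards [hf.ae_hasDerivAt_integral] with t ht htm
    rw [hIcc] at ht
    exact (ht htm a (left_mem_Icc.2 hab.le)).deriv
  have hIoc : uIoc a b ⊆ Icc a b := by rw [uIoc_of_le hab.le]; exact Ioc_subset_Icc_self
  have h0 := h ψ D hψL hψa hψb
  have h1 := hQac.integral_deriv_mul_eq_sub hψac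
  rw [hψa, hψb, mul_zero, mul_zero, sub_zero] at h1
  have hpg : IntervalIntegrable (fun t => p t * g t + f t * ψ t) volume a b := by
    refine IntervalIntegrable.add ?_ (hf.mul_continuousOn (by rw [hIcc]; exact hψL.continuousOn))
    refine intervalIntegrable_of_ae_norm_le (C := M * D) hab.le ?_ ?_
    · have e1 := (intervalIntegrable_iff_integrableOn_Icc_of_le hab.le).1 hp
      have e2 := (intervalIntegrable_iff_integrableOn_Icc_of_le hab.le).1 hgi
      exact e1.aestronglyMeasurable.mul e2.aestronglyMeasurable
    · filter_upwards [hpM, hD] with t ht1 ht2 htm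
      rw [norm_mul]
      exact mul_le_mul (ht1 htm) (ht2 htm) (norm_nonneg _) M.2
  have hQg : IntervalIntegrable (fun t => f t * ψ t + Q t * g t) volume a b :=
    (hf.mul_continuousOn (by rw [hIcc]; exact hψL.continuousOn)).add
      (hgi.continuousOn_mul (by rw [hIcc]; exact hQL.continuousOn))
  -- Testing with `ψ' = g` and subtracting the integration by parts of `Q ψ` leaves `∫ (p - Q) g =
  -- 0`; since `∫ g = 0`, this is `∫ g² = 0`.
  have h2 : ∫ t in a..b, g t * g t = 0 := by
    have e0 : ∫ t in a..b, (p t * g t + f t * ψ t) = 0 := by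
      rw [← h0]
      apply intervalIntegral.integral_congr_ae
      filter_upwards [hψd] with t ht htm
      rw [ht (hIoc htm)]
    have e1 : ∫ t in a..b, (f t * ψ t + Q t * g t) = 0 := by
      rw [← h1]
      apply intervalIntegral.integral_congr_ae
      filter_upwards [hψd, hQd] with t ht ht' htm
      rw [ht (hIoc htm), ht' (hIoc htm)]
    have e2 : ∫ t in a..b, m * g t = 0 := by
      rw [intervalIntegral.integral_const_mul, hgint, mul_zero]
    have : ∀ t, g t * g t = (p t * g t + f t * ψ t) - (f t * ψ t + Q t * g t) - m * g t := by
      intro t; simp only [hg]; ring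
    simp_rw [this]
    rw [intervalIntegral.integral_sub (hpg.sub hQg) (hgi.const_mul m),
      intervalIntegral.integral_sub hpg hQg, e0, e1, e2]
    simp
  have hggi : IntervalIntegrable (fun t => g t * g t) volume a b := by
    refine intervalIntegrable_of_ae_norm_le (C := D * D) hab.le ?_ ?_
    · have e2 := (intervalIntegrable_iff_integrableOn_Icc_of_le hab.le).1 hgi
      exact e2.aestronglyMeasurable.mul e2.aestronglyMeasurable
    · filter_upwards [hD] with t ht2 htm
      rw [norm_mul]
      exact mul_le_mul (ht2 htm) (ht2 htm) (norm_nonneg _) D.2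
  rw [intervalIntegral.integral_eq_zero_iff_of_nonneg_ae
    (.of_forall fun t => mul_self_nonneg (g t)) hggi, Ioc_eq_empty (not_lt.2 hab.le), union_empty,
    Filter.EventuallyEq, ae_restrict_iff' measurableSet_Ioc] at h2
  refine ⟨m, ?_⟩
  have h3 : ∀ᵐ t : ℝ, t ≠ a := by simp [ae_iff, measure_singleton]
  filter_upwards [h2, h3] with t ht hta htm
  have := mul_self_eq_zero.1 (ht ⟨lt_of_le_of_ne htm.1 hta.symm, htm.2⟩)
  simp only [hg] at this
  linarith

end DuBoisReymond

end RadialConvexity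

end

noncomputable section

namespace RadialConvexity

/-! ### Metrics on open sets of a vector space and the first variation of the energy. -/

section Variation

open MeasureTheory
open scoped NNReal Topology

variable {E : Type*} [NormedAddCommGroup E] [NormedSpace ℝ E]

set_option synthInstance.maxHeartbeats 400000
set_option synthInstance.maxSize 1000

local instance instNormedAddCommGroupForm₁ : NormedAddCommGroup (E →L[ℝ] ℝ) :=
  ContinuousLinearMap.toNormedAddCommGroup

local instance instNormedSpaceForm₁ : NormedSpace ℝ (E →L[ℝ] ℝ) :=
  ContinuousLinearMap.toNormedSpace

local instance instNormedAddCommGroupForm₂ : NormedAddCommGroup (E →L[ℝ] E →L[ℝ] ℝ) :=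
  ContinuousLinearMap.toNormedAddCommGroup

local instance instNormedSpaceForm₂ : NormedSpace ℝ (E →L[ℝ] E →L[ℝ] ℝ) :=
  ContinuousLinearMap.toNormedSpace

local instance instNormedAddCommGroupForm₃ : NormedAddCommGroup (E →L[ℝ] E →L[ℝ] E →L[ℝ] ℝ) :=
  ContinuousLinearMap.toNormedAddCommGroup

local instance instNormedSpaceForm₃ : NormedSpace ℝ (E →L[ℝ] E →L[ℝ] E →L[ℝ] ℝ) :=
  ContinuousLinearMap.toNormedSpace

lemma aestronglyMeasurable_clm_apply {α X Y : Type*} [MeasurableSpace α] {μ : Measure α}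
    [NormedAddCommGroup X] [NormedSpace ℝ X] [NormedAddCommGroup Y] [NormedSpace ℝ Y]
    {L : α → X →L[ℝ] Y} {v : α → X} (hL : AEStronglyMeasurable L μ)
    (hv : AEStronglyMeasurable v μ) : AEStronglyMeasurable (fun t => L t (v t)) μ :=
  isBoundedBilinearMap_apply.continuous.comp_aestronglyMeasurable (hL.prodMk hv)

/-- `B` is a Riemannian metric of class `C²` on the open subset `U` of `E`. -/
structure IsMetricOn (B : E → E →L[ℝ] E →L[ℝ] ℝ) (U : Set E) : Prop where
  isOpen : IsOpen U
  contDiffOn : ContDiffOn ℝ 2 B U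
  symm : ∀ y ∈ U, ∀ v w, B y v w = B y w v
  pos : ∀ y ∈ U, ∀ v, v ≠ 0 → 0 < B y v v

namespace IsMetricOn

variable {B : E → E →L[ℝ] E →L[ℝ] ℝ} {U : Set E}

lemma mono (hB : IsMetricOn B U) {V : Set E} (hV : IsOpen V) (hVU : V ⊆ U) : IsMetricOn B V :=
  ⟨hV, hB.contDiffOn.mono hVU, fun y hy => hB.symm y (hVU hy), fun y hy => hB.pos y (hVU hy)⟩

lemma nonneg (hB : IsMetricOn B U) {y : E} (hy : y ∈ U) (v : E) : 0 ≤ B y v v := by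
  rcases eq_or_ne v 0 with rfl | h
  · simp
  · exact (hB.pos y hy v h).le

lemma hasFDerivAt (hB : IsMetricOn B U) {y : E} (hy : y ∈ U) : HasFDerivAt B (fderiv ℝ B y) y :=
  ((hB.contDiffOn.contDiffAt (hB.isOpen.mem_nhds hy)).differentiableAt two_ne_zero).hasFDerivAt

lemma continuousOn (hB : IsMetricOn B U) : ContinuousOn B U := hB.contDiffOn.continuousOn

lemma continuousOn_fderiv (hB : IsMetricOn B U) : ContinuousOn (fderiv ℝ B) U :=
  hB.contDiffOn.continuousOn_fderiv_of_isOpen hB.isOpen one_le_two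

/-- Positive definiteness makes `v ↦ B y v` injective, and `E` and its dual have the same dimension.
This is what allows indices to be raised. -/
lemma isInvertible [FiniteDimensional ℝ E] (hB : IsMetricOn B U) {y : E} (hy : y ∈ U) :
    (B y).IsInvertible := by
  have hinj : Function.Injective (B y : E →ₗ[ℝ] (E →L[ℝ] ℝ)) := by
    rw [← LinearMap.ker_eq_bot, LinearMap.ker_eq_bot']
    intro v hv
    by_contra hne
    have h1 := hB.pos y hy v hne
    have h2 : B y v = 0 := hv
    simp [h2] at h1
  have hrank : Module.finrank ℝ E = Module.finrank ℝ (E →L[ℝ] ℝ) := by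
    rw [← (LinearMap.toContinuousLinearMap : (E →ₗ[ℝ] ℝ) ≃ₗ[ℝ] (E →L[ℝ] ℝ)).finrank_eq]
    exact (Subspace.dual_finrank_eq (K := ℝ) (V := E)).symm
  have : FiniteDimensional ℝ (E →L[ℝ] ℝ) :=
    (LinearMap.toContinuousLinearMap : (E →ₗ[ℝ] ℝ) ≃ₗ[ℝ] (E →L[ℝ] ℝ)).finiteDimensional
  let e := LinearMap.linearEquivOfInjective (B y : E →ₗ[ℝ] (E →L[ℝ] ℝ)) hinj hrank
  exact ⟨e.toContinuousLinearEquiv, by ext v w; rfl⟩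

variable [FiniteDimensional ℝ E] {u : ℝ → E} {K : ℝ≥0} {a b : ℝ}

set_option maxHeartbeats 1000000 in
/-- The first variation of the energy vanishes at a minimizer. -/
theorem integral_first_variation_eq_zero (hB : IsMetricOn B U) (hab : a < b)
    (hu : LipschitzOnWith K u (Icc a b)) (huU : MapsTo u (Icc a b) U)
    (hmin : ∀ (φ : ℝ → E) (C : ℝ≥0), LipschitzOnWith C φ (Icc a b) → φ a = 0 → φ b = 0 →
      (∀ t ∈ Icc a b, u t + φ t ∈ U) →
      ∫ t in a..b, B (u t) (deriv u t) (deriv u t) ≤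
        ∫ t in a..b, B (u t + φ t) (deriv (fun s => u s + φ s) t) (deriv (fun s => u s + φ s) t))
    {ψ : ℝ → ℝ} {C : ℝ≥0} (hψ : LipschitzOnWith C ψ (Icc a b)) (hψa : ψ a = 0) (hψb : ψ b = 0)
    (e : E) :
    ∫ t in a..b, (2 * B (u t) (deriv u t) e * deriv ψ t
      + fderiv ℝ B (u t) e (deriv u t) (deriv u t) * ψ t) = 0 := by
  have hcomp : IsCompact (u '' Icc a b) := isCompact_Icc.image_of_continuousOn hu.continuousOn
  -- A compact neighbourhood of the curve inside `U` gives uniform bounds on `B` and its derivative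
  -- for all small variations.
  obtain ⟨δ, hδ, hδU⟩ := hcomp.exists_cthickening_subset_open hB.isOpen huU.image_subset
  set N := Metric.cthickening δ (u '' Icc a b) with hN
  have hNc : IsCompact N := hcomp.cthickening
  obtain ⟨C0, hC0⟩ := hNc.exists_bound_of_continuousOn (hB.continuousOn.mono hδU)
  obtain ⟨C1, hC1⟩ := hNc.exists_bound_of_continuousOn (hB.continuousOn_fderiv.mono hδU)
  obtain ⟨D, hD⟩ := isCompact_Icc.exists_bound_of_continuousOn hψ.continuousOn
  have hne : (Icc a b).Nonempty := nonempty_Icc.2 hab.le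
  have hD0 : 0 ≤ D := (norm_nonneg _).trans (hD a (left_mem_Icc.2 hab.le))
  have huaN : u a ∈ N := Metric.self_subset_cthickening _ ⟨a, left_mem_Icc.2 hab.le, rfl⟩
  have hC00 : 0 ≤ C0 := (norm_nonneg _).trans (hC0 _ huaN)
  have hC10 : 0 ≤ C1 := (norm_nonneg _).trans (hC1 _ huaN)
  -- For `|s| < s₀` the variation `s ψ e` has norm at most `δ`, as `|ψ| ≤ D`; the `+ 1` keeps the
  -- denominator positive.
  set s₀ : ℝ := δ / (D * ‖e‖ + 1) with hs₀
  have hs₀pos : 0 < s₀ := by positivity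
  have hmem : ∀ s ∈ Metric.ball (0 : ℝ) s₀, ∀ t ∈ Icc a b, u t + (s * ψ t) • e ∈ N := by
    intro s hs t ht
    refine Metric.mem_cthickening_of_dist_le _ (u t) _ _ ⟨t, ht, rfl⟩ ?_
    rw [dist_eq_norm, add_sub_cancel_left, norm_smul, norm_mul]
    rw [mem_ball_zero_iff] at hs
    calc ‖s‖ * ‖ψ t‖ * ‖e‖ ≤ s₀ * D * ‖e‖ := by gcongr; exact hD t ht
      _ ≤ s₀ * (D * ‖e‖ + 1) := by nlinarith
      _ = δ := by rw [hs₀]; field_simp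
  let : MeasurableSpace E := borel E
  have : BorelSpace E := ⟨rfl⟩
  set v : ℝ → E := deriv u with hv
  set ψ' : ℝ → ℝ := deriv ψ with hψ'
  have hvm : Measurable v := measurable_deriv u
  have hψm : Measurable ψ' := measurable_deriv ψ
  let F : ℝ → ℝ → ℝ := fun s t =>
    B (u t + (s * ψ t) • e) (v t + (s * ψ' t) • e) (v t + (s * ψ' t) • e)
  let F' : ℝ → ℝ → ℝ := fun s t =>
    fderiv ℝ B (u t + (s * ψ t) • e) (ψ t • e) (v t + (s * ψ' t) • e) (v t + (s * ψ' t) • e)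
      + B (u t + (s * ψ t) • e) (ψ' t • e) (v t + (s * ψ' t) • e)
      + B (u t + (s * ψ t) • e) (v t + (s * ψ' t) • e) (ψ' t • e)
  have hIoc : uIoc a b ⊆ Icc a b := by rw [uIoc_of_le hab.le]; exact Ioc_subset_Icc_self
  have hcs : ∀ s, ContinuousOn (fun t => u t + (s * ψ t) • e) (Icc a b) := fun s =>
    hu.continuousOn.add ((continuousOn_const.mul hψ.continuousOn).smul continuousOn_const)
  have hBm : ∀ s ∈ Metric.ball (0 : ℝ) s₀,
      AEStronglyMeasurable (fun t => B (u t + (s * ψ t) • e)) (volume.restrict (Icc a b)) :=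
    fun s hs => ((hB.continuousOn.mono hδU).comp (hcs s) (hmem s hs)).aestronglyMeasurable
      measurableSet_Icc
  have hDBm : ∀ s ∈ Metric.ball (0 : ℝ) s₀,
      AEStronglyMeasurable (fun t => fderiv ℝ B (u t + (s * ψ t) • e)) (volume.restrict (Icc a b)) :=
    fun s hs => ((hB.continuousOn_fderiv.mono hδU).comp (hcs s) (hmem s hs)).aestronglyMeasurable
      measurableSet_Icc
  have hwm : ∀ s, AEStronglyMeasurable (fun t => v t + (s * ψ' t) • e) (volume.restrict (Icc a b)) := by
    intro s
    refine hvm.aestronglyMeasurable.add ?_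
    exact ((hψm.const_mul s).aestronglyMeasurable).smul aestronglyMeasurable_const
  have hFm : ∀ s ∈ Metric.ball (0 : ℝ) s₀,
      AEStronglyMeasurable (F s) (volume.restrict (Icc a b)) := by
    intro s hs
    exact aestronglyMeasurable_clm_apply (aestronglyMeasurable_clm_apply (hBm s hs) (hwm s)) (hwm s)
  have h0 : (0 : ℝ) ∈ Metric.ball (0 : ℝ) s₀ := Metric.mem_ball_self hs₀pos
  have hF'm : AEStronglyMeasurable (F' 0) (volume.restrict (Icc a b)) := by
    have e1 : AEStronglyMeasurable (fun t => ψ t • e) (volume.restrict (Icc a b)) :=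
      (hψ.continuousOn.aestronglyMeasurable measurableSet_Icc).smul aestronglyMeasurable_const
    have e2 : AEStronglyMeasurable (fun t => ψ' t • e) (volume.restrict (Icc a b)) :=
      hψm.aestronglyMeasurable.smul aestronglyMeasurable_const
    exact ((aestronglyMeasurable_clm_apply (aestronglyMeasurable_clm_apply
      (aestronglyMeasurable_clm_apply (hDBm 0 h0) e1) (hwm 0)) (hwm 0)).add
      (aestronglyMeasurable_clm_apply (aestronglyMeasurable_clm_apply (hBm 0 h0) e2) (hwm 0))).add
      (aestronglyMeasurable_clm_apply (aestronglyMeasurable_clm_apply (hBm 0 h0) (hwm 0)) e2)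
  set W : ℝ := K + s₀ * C * ‖e‖ with hW
  have hW0 : 0 ≤ W := by positivity
  have hwb : ∀ᵐ t, t ∈ Icc a b → ∀ s ∈ Metric.ball (0 : ℝ) s₀, ‖v t + (s * ψ' t) • e‖ ≤ W := by
    filter_upwards [ae_norm_deriv_le_of_lipschitzOnWith hu,
      ae_norm_deriv_le_of_lipschitzOnWith hψ] with t h1 h2 ht s hs
    rw [mem_ball_zero_iff] at hs
    refine (norm_add_le _ _).trans (add_le_add (h1 ht) ?_)
    rw [norm_smul, norm_mul]
    gcongr
    exact h2 ht
  have hFb : ∀ᵐ t, t ∈ Icc a b → ‖F 0 t‖ ≤ C0 * W * W := by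
    filter_upwards [hwb] with t h1 ht
    exact ((B _).le_opNorm₂ _ _).trans (by
      gcongr
      · exact hC0 _ (hmem 0 h0 t ht)
      · exact h1 ht 0 h0
      · exact h1 ht 0 h0)
  have hF'b : ∀ᵐ t, t ∈ uIoc a b → ∀ s ∈ Metric.ball (0 : ℝ) s₀,
      ‖F' s t‖ ≤ C1 * (D * ‖e‖) * W * W + C0 * (C * ‖e‖) * W + C0 * W * (C * ‖e‖) := by
    filter_upwards [hwb, ae_norm_deriv_le_of_lipschitzOnWith hψ] with t h1 h2 ht s hs
    have hw := h1 (hIoc ht) s hs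
    have hy := hmem s hs t (hIoc ht)
    have e1 : ‖ψ t • e‖ ≤ D * ‖e‖ := by rw [norm_smul]; gcongr; exact hD t (hIoc ht)
    have e2 : ‖ψ' t • e‖ ≤ C * ‖e‖ := by rw [norm_smul]; gcongr; exact h2 (hIoc ht)
    refine (norm_add₃_le).trans (add_le_add (add_le_add ?_ ?_) ?_)
    · refine ((fderiv ℝ B _ _).le_opNorm₂ _ _).trans ?_
      gcongr
      refine ((fderiv ℝ B _).le_opNorm _).trans ?_
      gcongr
      exact hC1 _ hy
    · refine ((B _).le_opNorm₂ _ _).trans ?_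
      gcongr
      exact hC0 _ hy
    · refine ((B _).le_opNorm₂ _ _).trans ?_
      gcongr
      exact hC0 _ hy
  have hdiff : ∀ t ∈ Icc a b, ∀ s ∈ Metric.ball (0 : ℝ) s₀,
      HasDerivAt (fun s => F s t) (F' s t) s := by
    intro t ht s hs
    have hy : HasDerivAt (fun s : ℝ => u t + (s * ψ t) • e) (ψ t • e) s := by
      simpa using (((hasDerivAt_id s).mul_const (ψ t)).smul_const e).const_add (u t)
    have hw : HasDerivAt (fun s : ℝ => v t + (s * ψ' t) • e) (ψ' t • e) s := by
      simpa using (((hasDerivAt_id s).mul_const (ψ' t)).smul_const e).const_add (v t)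
    have hBy := (hB.hasFDerivAt (hδU (hmem s hs t ht))).comp_hasDerivAt s hy
    have := (hBy.clm_apply hw).clm_apply hw
    simpa [F, F', add_assoc] using this
  -- Differentiation under the integral sign, dominated by the bound in `hF'b`, which does not
  -- depend on `s`.
  obtain ⟨-, hJ⟩ := intervalIntegral.hasDerivAt_integral_of_dominated_loc_of_deriv_le
    (F := F) (F' := F') (x₀ := 0) (a := a) (b := b) (μ := volume) (Metric.ball_mem_nhds 0 hs₀pos)
    (by
      filter_upwards [Metric.ball_mem_nhds 0 hs₀pos] with s hs
      exact (hFm s hs).mono_set hIoc)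
    (intervalIntegrable_of_ae_norm_le hab.le (hFm 0 h0) hFb) (hF'm.mono_set hIoc) hF'b
    intervalIntegrable_const (.of_forall fun t ht => hdiff t (hIoc ht))
  have hJF : ∀ s, ∫ t in a..b, B (u t + (s * ψ t) • e)
      (deriv (fun r => u r + (s * ψ r) • e) t) (deriv (fun r => u r + (s * ψ r) • e) t) =
      ∫ t in a..b, F s t := by
    intro s
    apply intervalIntegral.integral_congr_ae
    filter_upwards [ae_differentiableAt_of_lipschitzOnWith hab.le hu,
      ae_differentiableAt_of_lipschitzOnWith hab.le hψ] with t h1 h2 ht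
    have : HasDerivAt (fun r => u r + (s * ψ r) • e) (v t + (s * ψ' t) • e) t :=
      (h1 (hIoc ht)).hasDerivAt.add (((h2 (hIoc ht)).hasDerivAt.const_mul s).smul_const e)
    rw [this.deriv]
  have hmin' : IsLocalMin (fun s => ∫ t in a..b, F s t) 0 := by
    filter_upwards [Metric.ball_mem_nhds 0 hs₀pos] with s hs
    have hφ : LipschitzOnWith (‖s‖₊ * C * ‖e‖₊) (fun t => (s * ψ t) • e) (Icc a b) := by
      apply LipschitzOnWith.of_dist_le_mul
      intro x hx y hy
      rw [dist_eq_norm, ← sub_smul, ← mul_sub, norm_smul, norm_mul]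
      have := hψ.dist_le_mul x hx y hy
      rw [dist_eq_norm] at this
      push_cast
      calc ‖s‖ * ‖ψ x - ψ y‖ * ‖e‖ ≤ ‖s‖ * (C * dist x y) * ‖e‖ := by gcongr
        _ = _ := by ring
    have := hmin _ _ hφ (by simp [hψa]) (by simp [hψb]) fun t ht => hδU (hmem s hs t ht)
    rw [hJF s] at this
    refine le_trans (le_of_eq ?_) this
    simp [F]
  have hzero := hmin'.hasDerivAt_eq_zero hJ
  rw [← hzero]
  apply intervalIntegral.integral_congr
  intro t ht
  rw [uIcc_of_le hab.le] at ht
  -- Symmetry merges the two terms in which a velocity is varied; this is the source of the factor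
  -- `2`.
  have hsym := hB.symm (u t) (huU ht) e (v t)
  simp only [F', zero_mul, zero_smul, add_zero, map_smul, smul_apply,
    smul_eq_mul, hsym]
  ring

end IsMetricOn

end Variation

end RadialConvexity

end

noncomputable section

namespace RadialConvexity

/-! ### Regularity of energy minimizers. -/

section Regularity

open MeasureTheory
open scoped NNReal Topology

variable {E : Type*} [NormedAddCommGroup E] [NormedSpace ℝ E]

set_option synthInstance.maxHeartbeats 400000
set_option synthInstance.maxSize 1000

attribute [local instance] instNormedAddCommGroupForm₁ instNormedSpaceForm₁
  instNormedAddCommGroupForm₂ instNormedSpaceForm₂ instNormedAddCommGroupForm₃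
  instNormedSpaceForm₃

lemma contDiffOn_one_of_eq_integral {F : Type*} [NormedAddCommGroup F] [NormedSpace ℝ F]
    [CompleteSpace F] {f u : ℝ → F} {a b : ℝ} (hab : a < b)
    (hf : ContinuousOn f (Icc a b)) {c : F} (hu : ∀ t ∈ Icc a b, u t = c + ∫ s in a..t, f s) :
    ContDiffOn ℝ 1 u (Icc a b) := by
  have h := fun t ht => hasDerivWithinAt_of_eq_integral hab.le hf hu (t := t) ht
  rw [contDiffOn_one_iff_derivWithin (uniqueDiffOn_Icc hab)]
  refine ⟨fun t ht => (h t ht).differentiableWithinAt, hf.congr fun t ht => ?_⟩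
  exact (h t ht).derivWithin (uniqueDiffOn_Icc hab t ht)

/-- The Christoffel symbols (of the first kind) `Γ(v, v)` of the metric `B`, as a linear form. -/
def christoffelForm (B : E → E →L[ℝ] E →L[ℝ] ℝ) (y v : E) : E →L[ℝ] ℝ :=
  fderiv ℝ B y v v - (1 / 2 : ℝ) • ((fderiv ℝ B y).flip v).flip v

lemma christoffelForm_apply (B : E → E →L[ℝ] E →L[ℝ] ℝ) (y v z : E) :
    christoffelForm B y v z = fderiv ℝ B y v v z - 1 / 2 * fderiv ℝ B y z v v := by
  simp [christoffelForm]

namespace IsMetricOn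

variable [FiniteDimensional ℝ E] {B : E → E →L[ℝ] E →L[ℝ] ℝ} {U : Set E}
  {u : ℝ → E} {K : ℝ≥0} {a b : ℝ}

/-- The momentum of a minimizer satisfies the integrated Euler-Lagrange equation. -/
lemma exists_momentum_eq_integral (hB : IsMetricOn B U) (hab : a < b)
    (hu : LipschitzOnWith K u (Icc a b)) (huU : MapsTo u (Icc a b) U)
    (hmin : ∀ (φ : ℝ → E) (C : ℝ≥0), LipschitzOnWith C φ (Icc a b) → φ a = 0 → φ b = 0 →
      (∀ t ∈ Icc a b, u t + φ t ∈ U) →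
      ∫ t in a..b, B (u t) (deriv u t) (deriv u t) ≤
        ∫ t in a..b, B (u t + φ t) (deriv (fun s => u s + φ s) t) (deriv (fun s => u s + φ s) t))
    (e : E) :
    IntervalIntegrable (fun t => 1 / 2 * fderiv ℝ B (u t) e (deriv u t) (deriv u t)) volume a b ∧
    ∃ c, ∀ᵐ t, t ∈ Icc a b → B (u t) (deriv u t) e =
      c + ∫ s in a..t, 1 / 2 * fderiv ℝ B (u s) e (deriv u s) (deriv u s) := by
  let : MeasurableSpace E := borel E
  have : BorelSpace E := ⟨rfl⟩
  have hvm : AEStronglyMeasurable (deriv u) (volume.restrict (Icc a b)) :=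
    (measurable_deriv u).aestronglyMeasurable
  have hBm : AEStronglyMeasurable (fun t => B (u t)) (volume.restrict (Icc a b)) :=
    (hB.continuousOn.comp hu.continuousOn huU).aestronglyMeasurable measurableSet_Icc
  have hDBm : AEStronglyMeasurable (fun t => fderiv ℝ B (u t)) (volume.restrict (Icc a b)) :=
    (hB.continuousOn_fderiv.comp hu.continuousOn huU).aestronglyMeasurable measurableSet_Icc
  obtain ⟨C0, hC0⟩ := isCompact_Icc.exists_bound_of_continuousOn
    (hB.continuousOn.comp hu.continuousOn huU)
  obtain ⟨C1, hC1⟩ := isCompact_Icc.exists_bound_of_continuousOn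
    (hB.continuousOn_fderiv.comp hu.continuousOn huU)
  have hC00 : 0 ≤ C0 := (norm_nonneg _).trans (hC0 a (left_mem_Icc.2 hab.le))
  have hC10 : 0 ≤ C1 := (norm_nonneg _).trans (hC1 a (left_mem_Icc.2 hab.le))
  have hpb : ∀ᵐ t, t ∈ Icc a b → ‖B (u t) (deriv u t) e‖ ≤ C0 * K * ‖e‖ := by
    filter_upwards [ae_norm_deriv_le_of_lipschitzOnWith hu] with t h1 ht
    refine ((B _).le_opNorm₂ _ _).trans ?_
    gcongr
    exacts [hC0 t ht, h1 ht]
  have hfb : ∀ᵐ t, t ∈ Icc a b →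
      ‖1 / 2 * fderiv ℝ B (u t) e (deriv u t) (deriv u t)‖ ≤ C1 * ‖e‖ * K * K := by
    filter_upwards [ae_norm_deriv_le_of_lipschitzOnWith hu] with t h1 ht
    rw [norm_mul]
    refine (mul_le_of_le_one_left (norm_nonneg _) (by norm_num)).trans ?_
    refine ((fderiv ℝ B _ _).le_opNorm₂ _ _).trans ?_
    gcongr
    · refine ((fderiv ℝ B _).le_opNorm _).trans ?_
      gcongr
      exact hC1 t ht
    · exact h1 ht
    · exact h1 ht
  have hpi : IntervalIntegrable (fun t => B (u t) (deriv u t) e) volume a b :=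
    intervalIntegrable_of_ae_norm_le hab.le (aestronglyMeasurable_clm_apply
      (aestronglyMeasurable_clm_apply hBm hvm) aestronglyMeasurable_const) hpb
  have hfi : IntervalIntegrable (fun t => 1 / 2 * fderiv ℝ B (u t) e (deriv u t) (deriv u t))
      volume a b :=
    intervalIntegrable_of_ae_norm_le hab.le (aestronglyMeasurable_const.mul
      (aestronglyMeasurable_clm_apply (aestronglyMeasurable_clm_apply
        (aestronglyMeasurable_clm_apply hDBm aestronglyMeasurable_const) hvm) hvm)) hfb
  refine ⟨hfi, ?_⟩
  set M : ℝ := max (C0 * K * ‖e‖) (C1 * ‖e‖ * K * K) with hM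
  refine ae_eq_const_add_integral (M := M.toNNReal) hab hpi ?_ hfi ?_ ?_
  · filter_upwards [hpb] with t h1 ht
    exact ((h1 ht).trans (le_max_left _ _)).trans (Real.le_coe_toNNReal M)
  · filter_upwards [hfb] with t h1 ht
    exact ((h1 ht).trans (le_max_right _ _)).trans (Real.le_coe_toNNReal M)
  · intro ψ C hψ hψa hψb
    have h := hB.integral_first_variation_eq_zero hab hu huU hmin hψ hψa hψb e
    rw [← mul_right_inj' (two_ne_zero (α := ℝ)), mul_zero, ← h,
      ← intervalIntegral.integral_const_mul]
    apply intervalIntegral.integral_congr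
    intro t _
    ring

set_option maxHeartbeats 1000000 in
/-- A Lipschitz minimizer of the energy is of class `C²` and satisfies the geodesic equation. -/
theorem contDiffOn_and_geodesic_eq (hB : IsMetricOn B U) (hab : a < b)
    (hu : LipschitzOnWith K u (Icc a b)) (huU : MapsTo u (Icc a b) U)
    (hmin : ∀ (φ : ℝ → E) (C : ℝ≥0), LipschitzOnWith C φ (Icc a b) → φ a = 0 → φ b = 0 →
      (∀ t ∈ Icc a b, u t + φ t ∈ U) →
      ∫ t in a..b, B (u t) (deriv u t) (deriv u t) ≤
        ∫ t in a..b, B (u t + φ t) (deriv (fun s => u s + φ s) t) (deriv (fun s => u s + φ s) t)) :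
    ContDiffOn ℝ 2 u (Icc a b) ∧ ∀ t ∈ Icc a b,
      B (u t) (derivWithin (derivWithin u (Icc a b)) (Icc a b) t)
        + christoffelForm B (u t) (derivWithin u (Icc a b) t) = 0 := by
  have hud := uniqueDiffOn_Icc hab
  let bs := Module.finBasis ℝ E
  have hex := fun i => hB.exists_momentum_eq_integral hab hu huU hmin (bs i)
  choose hfi c hc using hex
  let ρ := fun i (t : ℝ) =>
    c i + ∫ s in a..t, 1 / 2 * fderiv ℝ B (u s) (bs i) (deriv u s) (deriv u s)
  have hρc : ∀ i, ContinuousOn (ρ i) (Icc a b) := by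
    intro i
    refine continuousOn_const.add ?_
    rw [← uIcc_of_le hab.le]
    exact intervalIntegral.continuousOn_primitive_interval'
      (hfi i) left_mem_uIcc
  let R : ℝ → E →L[ℝ] ℝ := fun t =>
    -- `R` is the continuous covector whose components are the integrals `ρ i`; it equals the
    -- momentum `B u u'` almost everywhere.
    ∑ i, ρ i t • LinearMap.toContinuousLinearMap (bs.coord i)
  have hRbs : ∀ t i, R t (bs i) = ρ i t := by
    intro t i
    simp only [R, sum_apply, smul_apply,
      LinearMap.coe_toContinuousLinearMap', Module.Basis.coord_apply, Module.Basis.repr_self,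
      smul_eq_mul, Finsupp.single_apply]
    simp
  have hRc : ContinuousOn R (Icc a b) :=
    continuousOn_finsetSum _ fun i _ => (hρc i).smul continuousOn_const
  have hinv : ∀ {n : ℕ∞ω}, ∀ t ∈ Icc a b,
      ContDiffAt ℝ n (ContinuousLinearMap.inverse : (E →L[ℝ] E →L[ℝ] ℝ) → _) (B (u t)) :=
    fun t ht => (hB.isInvertible (huU ht)).contDiffAt_map_inverse
  -- Raising the index turns the momentum into a continuous representative of `u'`.
  let w : ℝ → E := fun t => (B (u t)).inverse (R t)
  have hBu : ContinuousOn (fun t => B (u t)) (Icc a b) :=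
    hB.continuousOn.comp hu.continuousOn huU
  have hwc : ContinuousOn w (Icc a b) := by
    refine ContinuousOn.clm_apply (fun t ht => ?_) hRc
    exact ContinuousAt.comp_continuousWithinAt (f := fun t => B (u t))
      (hinv (n := 0) t ht).continuousAt (hBu t ht)
  have hBw : ∀ t ∈ Icc a b, B (u t) (w t) = R t := fun t ht =>
    (hB.isInvertible (huU ht)).self_apply_inverse _
  have hderiv : ∀ᵐ t, t ∈ Icc a b → deriv u t = w t := by
    filter_upwards [ae_all_iff.2 hc] with t h1 ht
    symm
    rw [(hB.isInvertible (huU ht)).inverse_apply_eq]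
    have : (R t : E →ₗ[ℝ] ℝ) = (B (u t) (deriv u t) : E →ₗ[ℝ] ℝ) :=
      bs.ext fun i => by
        change R t (bs i) = B (u t) (deriv u t) (bs i)
        rw [hRbs, h1 i ht]
    exact ContinuousLinearMap.coe_injective this
  have hui : ∀ t ∈ Icc a b, u t = u a + ∫ s in a..t, w s := fun t ht =>
    eq_integral_of_ae_deriv_eq hab.le hu hwc hderiv ht
  have hud1 : ∀ t ∈ Icc a b, HasDerivWithinAt u (w t) (Icc a b) t := fun t ht =>
    hasDerivWithinAt_of_eq_integral hab.le hwc hui ht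
  have huC1 : ContDiffOn ℝ 1 u (Icc a b) := contDiffOn_one_of_eq_integral hab hwc hui
  have hdw : ∀ t ∈ Icc a b, derivWithin u (Icc a b) t = w t := fun t ht =>
    (hud1 t ht).derivWithin (hud t ht)
  let G := fun i (t : ℝ) => 1 / 2 * fderiv ℝ B (u t) (bs i) (w t) (w t)
  have hGc : ∀ i, ContinuousOn (G i) (Icc a b) := fun i =>
    continuousOn_const.mul ((((hB.continuousOn_fderiv.comp hu.continuousOn huU).clm_apply
      continuousOn_const).clm_apply hwc).clm_apply hwc)
  -- Bootstrap: with `w` in place of `deriv u` the integrand is continuous, so `ρ`, `R` and then `w`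
  -- are `C¹`, and `u` is `C²`.
  have hρG : ∀ i, ∀ t ∈ Icc a b, ρ i t = c i + ∫ s in a..t, G i s := by
    intro i t ht
    refine congrArg (c i + ·) (intervalIntegral.integral_congr_ae ?_)
    filter_upwards [hderiv] with s hs hst
    rw [uIoc_of_le ht.1] at hst
    rw [hs ⟨hst.1.le, hst.2.trans ht.2⟩]
  have hρC1 : ∀ i, ContDiffOn ℝ 1 (ρ i) (Icc a b) := fun i =>
    contDiffOn_one_of_eq_integral hab (hGc i) (hρG i)
  have hRC1 : ContDiffOn ℝ 1 R (Icc a b) :=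
    ContDiffOn.sum fun i _ => (hρC1 i).smul contDiffOn_const
  have hwC1 : ContDiffOn ℝ 1 w (Icc a b) := by
    refine ContDiffOn.clm_apply (fun t ht => ?_) hRC1
    exact ContDiffAt.comp_contDiffWithinAt t (hinv t ht)
      (((hB.contDiffOn.of_le one_le_two).comp huC1 huU) t ht)
  have huC2 : ContDiffOn ℝ 2 u (Icc a b) := by
    rw [show (2 : ℕ∞ω) = 1 + 1 by norm_num, contDiffOn_succ_iff_derivWithin hud]
    exact ⟨fun t ht => (hud1 t ht).differentiableWithinAt, by simp, hwC1.congr hdw⟩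
  refine ⟨huC2, fun t ht => ?_⟩
  have hw' : HasDerivWithinAt w (derivWithin w (Icc a b) t) (Icc a b) t :=
    ((hwC1.differentiableOn one_ne_zero) t ht).hasDerivWithinAt
  have hd2 : derivWithin (derivWithin u (Icc a b)) (Icc a b) t = derivWithin w (Icc a b) t :=
    derivWithin_congr hdw (hdw t ht)
  rw [hd2, hdw t ht]
  apply ContinuousLinearMap.coe_injective
  refine bs.ext fun i => ?_
  -- The momentum is differentiated twice, by the product rule and from its integral formula `ρ`;
  -- equating the results gives the geodesic equation.
  have h1 : HasDerivWithinAt (fun s => B (u s) (w s) (bs i))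
      (fderiv ℝ B (u t) (w t) (w t) (bs i) + B (u t) (derivWithin w (Icc a b) t) (bs i))
      (Icc a b) t := by
    have h2 := (hB.hasFDerivAt (huU ht)).comp_hasDerivWithinAt t (hud1 t ht)
    simpa using (h2.clm_apply hw').clm_apply (hasDerivWithinAt_const t (Icc a b) (bs i))
  have h3 : HasDerivWithinAt (fun s => B (u s) (w s) (bs i)) (G i t) (Icc a b) t := by
    refine (hasDerivWithinAt_of_eq_integral hab.le (hGc i) (hρG i) ht).congr_of_mem ?_ ht
    intro s hs
    rw [hBw s hs, hRbs]
  have h4 := (hud t ht).eq_deriv _ h1 h3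
  change B (u t) (derivWithin w (Icc a b) t) (bs i) + christoffelForm B (u t) (w t) (bs i) = 0
  rw [christoffelForm_apply]
  simp only [G] at h4
  linarith

end IsMetricOn

end Regularity

end RadialConvexity

end

noncomputable section

namespace RadialConvexity

/-! ### Local uniqueness for the geodesic equation. -/

section GeodesicUniqueness

open scoped NNReal Topology

variable {E : Type*} [NormedAddCommGroup E] [NormedSpace ℝ E]

set_option synthInstance.maxHeartbeats 400000
set_option synthInstance.maxSize 1000

attribute [local instance] instNormedAddCommGroupForm₁ instNormedSpaceForm₁
  instNormedAddCommGroupForm₂ instNormedSpaceForm₂ instNormedAddCommGroupForm₃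
  instNormedSpaceForm₃

namespace IsMetricOn

variable [FiniteDimensional ℝ E] {B : E → E →L[ℝ] E →L[ℝ] ℝ} {U : Set E}

/-- The vector field on `E × E` whose integral curves are the velocities of the geodesics. -/
def geodesicField (B : E → E →L[ℝ] E →L[ℝ] ℝ) (p : E × E) : E × E :=
  (p.2, -(B p.1).inverse (christoffelForm B p.1 p.2))

/-- The form involves one derivative of the `C²` metric, so it is `C¹`: enough for the local
Lipschitz bound in the uniqueness theorem for ODEs. -/
lemma contDiffAt_christoffelForm (hB : IsMetricOn B U) {p : E × E} (hp : p.1 ∈ U) :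
    ContDiffAt ℝ 1 (fun q : E × E => christoffelForm B q.1 q.2) p := by
  have hopen : IsOpen (U ×ˢ (univ : Set E)) := hB.isOpen.prod isOpen_univ
  have hD : ContDiffOn ℝ 1 (fun q : E × E => fderiv ℝ B q.1) (U ×ˢ univ) :=
    (hB.contDiffOn.fderiv_of_isOpen hB.isOpen (by norm_num)).comp contDiffOn_fst fun q hq => hq.1
  have hs : ContDiffOn ℝ 1 (fun q : E × E => q.2) (U ×ˢ univ) := contDiffOn_snd
  refine ContDiffOn.contDiffAt (s := U ×ˢ univ) ?_ (hopen.mem_nhds ⟨hp, mem_univ _⟩)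
  rw [contDiffOn_clm_apply]
  intro z
  simp only [christoffelForm_apply]
  exact (((hD.clm_apply hs).clm_apply hs).clm_apply contDiffOn_const).sub
    (contDiffOn_const.mul (((hD.clm_apply contDiffOn_const).clm_apply hs).clm_apply hs))

lemma contDiffAt_geodesicField (hB : IsMetricOn B U) {p : E × E} (hp : p.1 ∈ U) :
    ContDiffAt ℝ 1 (geodesicField B) p := by
  refine contDiffAt_snd.prodMk (ContDiffAt.neg ?_)
  refine ContDiffAt.clm_apply ?_ (hB.contDiffAt_christoffelForm hp)
  have h1 : ContDiffAt ℝ 1 B p.1 :=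
    (hB.contDiffOn.of_le one_le_two).contDiffAt (hB.isOpen.mem_nhds hp)
  have h2 : ContDiffAt ℝ 1 (fun q : E × E => B q.1) p := h1.comp p contDiffAt_fst
  exact ContDiffAt.comp (f := fun q : E × E => B q.1) p
    (hB.isInvertible hp).contDiffAt_map_inverse h2

/-- Local uniqueness of the solutions of the geodesic equation. -/
theorem exists_eqOn_of_geodesic_eq (hB : IsMetricOn B U) {t₀ t₁ : ℝ} (ht : t₀ < t₁)
    {u₁ w₁ a₁ u₂ w₂ a₂ : ℝ → E}
    (hu₁ : ∀ t ∈ Icc t₀ t₁, HasDerivWithinAt u₁ (w₁ t) (Icc t₀ t₁) t)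
    (hw₁ : ∀ t ∈ Icc t₀ t₁, HasDerivWithinAt w₁ (a₁ t) (Icc t₀ t₁) t)
    (hU₁ : ∀ t ∈ Icc t₀ t₁, u₁ t ∈ U)
    (hg₁ : ∀ t ∈ Icc t₀ t₁, B (u₁ t) (a₁ t) + christoffelForm B (u₁ t) (w₁ t) = 0)
    (hu₂ : ∀ t ∈ Icc t₀ t₁, HasDerivWithinAt u₂ (w₂ t) (Icc t₀ t₁) t)
    (hw₂ : ∀ t ∈ Icc t₀ t₁, HasDerivWithinAt w₂ (a₂ t) (Icc t₀ t₁) t)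
    (hU₂ : ∀ t ∈ Icc t₀ t₁, u₂ t ∈ U)
    (hg₂ : ∀ t ∈ Icc t₀ t₁, B (u₂ t) (a₂ t) + christoffelForm B (u₂ t) (w₂ t) = 0)
    (hu : u₁ t₀ = u₂ t₀) (hw : w₁ t₀ = w₂ t₀) :
    ∃ t₂ ∈ Ioc t₀ t₁, ∀ t ∈ Icc t₀ t₂, u₁ t = u₂ t := by
  have hl : t₀ ∈ Icc t₀ t₁ := left_mem_Icc.2 ht.le
  obtain ⟨K, s, hs, hK⟩ := (hB.contDiffAt_geodesicField (p := (u₁ t₀, w₁ t₀))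
    (hU₁ t₀ hl)).exists_lipschitzOnWith
  have hcurve : ∀ {u w a : ℝ → E},
      (∀ t ∈ Icc t₀ t₁, HasDerivWithinAt u (w t) (Icc t₀ t₁) t) →
      (∀ t ∈ Icc t₀ t₁, HasDerivWithinAt w (a t) (Icc t₀ t₁) t) →
      (∀ t ∈ Icc t₀ t₁, u t ∈ U) →
      (∀ t ∈ Icc t₀ t₁, B (u t) (a t) + christoffelForm B (u t) (w t) = 0) →
      ∀ t ∈ Icc t₀ t₁, HasDerivWithinAt (fun t => (u t, w t)) (geodesicField B (u t, w t))
        (Icc t₀ t₁) t := by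
    intro u w a h1 h2 h3 h4 t htt
    have ha : geodesicField B (u t, w t) = (w t, a t) := by
      have : (B (u t)).inverse (-christoffelForm B (u t) (w t)) = a t := by
        rw [(hB.isInvertible (h3 t htt)).inverse_apply_eq]
        exact (eq_neg_of_add_eq_zero_left (h4 t htt)).symm
      rw [map_neg] at this
      simp [geodesicField, this]
    rw [ha]
    exact (h1 t htt).prodMk (h2 t htt)
  have hd₁ := hcurve hu₁ hw₁ hU₁ hg₁
  have hd₂ := hcurve hu₂ hw₂ hU₂ hg₂
  have hc₁ : ContinuousOn (fun t => (u₁ t, w₁ t)) (Icc t₀ t₁) :=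
    fun t h => (hd₁ t h).continuousWithinAt
  have hc₂ : ContinuousOn (fun t => (u₂ t, w₂ t)) (Icc t₀ t₁) :=
    fun t h => (hd₂ t h).continuousWithinAt
  have hm₁ := hc₁ t₀ hl hs
  have hm₂ := hc₂ t₀ hl (show s ∈ 𝓝 (u₂ t₀, w₂ t₀) by rw [← hu, ← hw]; exact hs)
  rw [Filter.mem_map, nhdsWithin_Icc_eq_nhdsGE ht] at hm₁ hm₂
  -- Up to `t₃` both phase curves stay in the set `s` on which the field is Lipschitz.
  obtain ⟨t₃, ht₃, h₃⟩ := mem_nhdsGE_iff_exists_Icc_subset.1 (Filter.inter_mem hm₁ hm₂)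
  have hsub : Icc t₀ (min t₁ t₃) ⊆ Icc t₀ t₁ := Icc_subset_Icc_right (min_le_left _ _)
  have hsub' : ∀ t ∈ Ico t₀ (min t₁ t₃), t ∈ Icc t₀ t₁ ∧ t ∈ Icc t₀ t₃ := fun t h =>
    ⟨⟨h.1, h.2.le.trans (min_le_left _ _)⟩, ⟨h.1, h.2.le.trans (min_le_right _ _)⟩⟩
  have hnhds : ∀ t ∈ Ico t₀ (min t₁ t₃), Icc t₀ t₁ ∈ 𝓝[≥] t := fun t h =>
    Icc_mem_nhdsGE_of_mem ⟨h.1, h.2.trans_le (min_le_left _ _)⟩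
  have heq := ODE_solution_unique_of_mem_Icc_right (v := fun _ => geodesicField B)
    (s := fun _ => s) (K := K) (a := t₀) (b := min t₁ t₃) (fun _ _ => hK)
    (hc₁.mono hsub) (fun t h => (hd₁ t (hsub' t h).1).mono_of_mem_nhdsWithin (hnhds t h))
    (fun t h => (h₃ (hsub' t h).2).1)
    (hc₂.mono hsub) (fun t h => (hd₂ t (hsub' t h).1).mono_of_mem_nhdsWithin (hnhds t h))
    (fun t h => (h₃ (hsub' t h).2).2) (by simp [hu, hw])
  exact ⟨min t₁ t₃, ⟨lt_min ht ht₃, min_le_left _ _⟩, fun t h => congrArg Prod.fst (heq h)⟩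

end IsMetricOn

end GeodesicUniqueness

end RadialConvexity

end

noncomputable section

namespace RadialConvexity

/-! ### The Riemannian metric read in a chart. -/

section Chart

open scoped NNReal Topology

variable {E : Type*} [NormedAddCommGroup E] [NormedSpace ℝ E]
  {M : Type*} [TopologicalSpace M] [ChartedSpace E M]
  [RiemannianBundle (fun x : M => TangentSpace 𝓘(ℝ, E) x)]

set_option synthInstance.maxHeartbeats 400000
set_option synthInstance.maxSize 1000

attribute [local instance] instNormedAddCommGroupForm₁ instNormedSpaceForm₁
  instNormedAddCommGroupForm₂ instNormedSpaceForm₂ instNormedAddCommGroupForm₃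
  instNormedSpaceForm₃

/-- The norm of the tangent vector of `M` with coordinates `v` at the point `y` of the chart
around `x₀`. -/
def chartNorm (x₀ : M) (y v : E) : ℝ :=
  ‖(mfderiv 𝓘(ℝ, E) 𝓘(ℝ, E) (extChartAt 𝓘(ℝ, E) x₀).symm y v :
      TangentSpace 𝓘(ℝ, E) ((extChartAt 𝓘(ℝ, E) x₀).symm y))‖

lemma chartMetric_self (x₀ : M) (y v : E) : chartMetric x₀ y v v = chartNorm x₀ y v ^ 2 :=
  real_inner_self_eq_norm_sq (F := TangentSpace 𝓘(ℝ, E) ((extChartAt 𝓘(ℝ, E) x₀).symm y)) _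

lemma chartNorm_nonneg (x₀ : M) (y v : E) : 0 ≤ chartNorm x₀ y v :=
  norm_nonneg (E := TangentSpace 𝓘(ℝ, E) ((extChartAt 𝓘(ℝ, E) x₀).symm y)) _

lemma chartNorm_eq_sqrt (x₀ : M) (y v : E) : chartNorm x₀ y v = √(chartMetric x₀ y v v) := by
  rw [chartMetric_self, Real.sqrt_sq (chartNorm_nonneg x₀ y v)]

lemma abs_chartMetric_le (x₀ : M) (y v w : E) :
    |chartMetric x₀ y v w| ≤ chartNorm x₀ y v * chartNorm x₀ y w :=
  abs_real_inner_le_norm (F := TangentSpace 𝓘(ℝ, E) ((extChartAt 𝓘(ℝ, E) x₀).symm y)) _ _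

lemma chartMetric_comm (x₀ : M) (y v w : E) : chartMetric x₀ y v w = chartMetric x₀ y w v :=
  real_inner_comm (F := TangentSpace 𝓘(ℝ, E) ((extChartAt 𝓘(ℝ, E) x₀).symm y)) _ _

lemma chartMetric_add_left (x₀ : M) (y v v' w : E) :
    chartMetric x₀ y (v + v') w = chartMetric x₀ y v w + chartMetric x₀ y v' w := by
  have h := map_add (mfderiv 𝓘(ℝ, E) 𝓘(ℝ, E) (extChartAt 𝓘(ℝ, E) x₀).symm y) v v'
  unfold chartMetric
  erw [h]
  exact inner_add_left (E := TangentSpace 𝓘(ℝ, E) ((extChartAt 𝓘(ℝ, E) x₀).symm y)) _ _ _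

lemma chartMetric_smul_left (x₀ : M) (y : E) (c : ℝ) (v w : E) :
    chartMetric x₀ y (c • v) w = c * chartMetric x₀ y v w := by
  have h := map_smul (mfderiv 𝓘(ℝ, E) 𝓘(ℝ, E) (extChartAt 𝓘(ℝ, E) x₀).symm y) c v
  unfold chartMetric
  erw [h]
  exact real_inner_smul_left (F := TangentSpace 𝓘(ℝ, E) ((extChartAt 𝓘(ℝ, E) x₀).symm y)) _ _ _

variable [FiniteDimensional ℝ E]

/-- The Riemannian metric in the chart around `x₀`, as a field of continuous bilinear forms. -/
def chartForm (x₀ : M) (y : E) : E →L[ℝ] E →L[ℝ] ℝ :=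
  LinearMap.toContinuousLinearMap
    ((LinearMap.toContinuousLinearMap : (E →ₗ[ℝ] ℝ) ≃ₗ[ℝ] (E →L[ℝ] ℝ)).toLinearMap ∘ₗ
      LinearMap.mk₂ ℝ (chartMetric x₀ y) (chartMetric_add_left x₀ y) (chartMetric_smul_left x₀ y)
        (fun v w w' => by
          rw [chartMetric_comm, chartMetric_add_left, chartMetric_comm x₀ y w,
            chartMetric_comm x₀ y w'])
        (fun c v w => by
          rw [chartMetric_comm, chartMetric_smul_left, chartMetric_comm x₀ y w]; rfl))

lemma chartForm_apply (x₀ : M) (y v w : E) : chartForm x₀ y v w = chartMetric x₀ y v w := rfl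

variable [IsManifold 𝓘(ℝ, E) ∞ M]

omit [FiniteDimensional ℝ E] [RiemannianBundle (fun x : M => TangentSpace 𝓘(ℝ, E) x)] in
-- The field is the tangent map of the inverse chart applied to the constant field `v`. It makes the
-- metric coefficients inner products of smooth enough sections.
lemma contMDiffOn_mfderiv_extChartAt_symm (x₀ : M) (v : E) :
    ContMDiffOn 𝓘(ℝ, E) 𝓘(ℝ, E).tangent 2
      (fun y => (⟨(extChartAt 𝓘(ℝ, E) x₀).symm y,
        mfderiv 𝓘(ℝ, E) 𝓘(ℝ, E) (extChartAt 𝓘(ℝ, E) x₀).symm y v⟩ : TangentBundle 𝓘(ℝ, E) M))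
      (extChartAt 𝓘(ℝ, E) x₀).target := by
  have hopen := isOpen_extChartAt_target (I := 𝓘(ℝ, E)) x₀
  have h1 := (contMDiffOn_extChartAt_symm (I := 𝓘(ℝ, E)) (n := ∞) x₀).contMDiffOn_tangentMapWithin
    (m := 2) (by norm_num; exact ENat.LEInfty.out) hopen.uniqueMDiffOn
  have h2 : ContMDiff 𝓘(ℝ, E) 𝓘(ℝ, E).tangent 2
      (fun y : E => (⟨y, v⟩ : TangentBundle 𝓘(ℝ, E) E)) := fun y => by
    have := contMDiffWithinAt_vectorSpace_iff_contDiffWithinAt (𝕜 := ℝ) (n := 2) (s := univ)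
      (x := y) (V := fun y : E => (v : TangentSpace 𝓘(ℝ, E) y))
    rw [← contMDiffWithinAt_univ]
    exact this.2 contDiffWithinAt_const
  refine (h1.comp (h2.contMDiffOn (s := (extChartAt 𝓘(ℝ, E) x₀).target)) fun y hy => hy).congr ?_
  intro y hy
  simp only [tangentMapWithin, Function.comp_apply]
  rw [mfderivWithin_of_mem_nhds (hopen.mem_nhds hy)]

omit [FiniteDimensional ℝ E] in
lemma contDiffOn_chartMetric
    [IsContMDiffRiemannianBundle 𝓘(ℝ, E) ∞ E (fun x : M => TangentSpace 𝓘(ℝ, E) x)]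
    (x₀ : M) (v w : E) :
    ContDiffOn ℝ 2 (fun y => chartMetric x₀ y v w) (extChartAt 𝓘(ℝ, E) x₀).target := by
  rw [← contMDiffOn_iff_contDiffOn]
  exact ContMDiffOn.inner_bundle (IB := 𝓘(ℝ, E)) (n := 2)
    (E := fun x : M => TangentSpace 𝓘(ℝ, E) x)
    (contMDiffOn_mfderiv_extChartAt_symm x₀ v) (contMDiffOn_mfderiv_extChartAt_symm x₀ w)

omit [FiniteDimensional ℝ E] in
lemma chartMetric_pos (x₀ : M) {y : E} (hy : y ∈ (extChartAt 𝓘(ℝ, E) x₀).target) {v : E}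
    (hv : v ≠ 0) : 0 < chartMetric x₀ y v v := by
  have h := isInvertible_mfderivWithin_extChartAt_symm (I := 𝓘(ℝ, E)) hy
  rw [mfderivWithin_of_mem_nhds (by simp)] at h
  have hne : mfderiv 𝓘(ℝ, E) 𝓘(ℝ, E) (extChartAt 𝓘(ℝ, E) x₀).symm y v ≠ 0 := by
    intro h0
    apply hv
    exact h.injective (h0.trans (map_zero _).symm)
  exact real_inner_self_pos.2 hne

lemma isMetricOn_chartForm
    [IsContMDiffRiemannianBundle 𝓘(ℝ, E) ∞ E (fun x : M => TangentSpace 𝓘(ℝ, E) x)] (x₀ : M) :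
    IsMetricOn (chartForm x₀) (extChartAt 𝓘(ℝ, E) x₀).target where
  isOpen := isOpen_extChartAt_target x₀
  contDiffOn := by
    rw [contDiffOn_clm_apply]
    intro v
    rw [contDiffOn_clm_apply]
    exact contDiffOn_chartMetric x₀ v
  symm _ _ v w := chartMetric_comm x₀ _ v w
  pos _ hy _ hv := chartMetric_pos x₀ hy hv

/-- On the diagonal the first two terms of the Koszul formula coincide and cancel the factor `1/2`.
-/
lemma chartChristoffel_self
    [IsContMDiffRiemannianBundle 𝓘(ℝ, E) ∞ E (fun x : M => TangentSpace 𝓘(ℝ, E) x)]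
    (x₀ : M) {y : E} (hy : y ∈ (extChartAt 𝓘(ℝ, E) x₀).target) (v z : E) :
    chartChristoffel x₀ y v v z = christoffelForm (chartForm x₀) y v z := by
  have h : ∀ v w, fderiv ℝ (fun y' => chartMetric x₀ y' v w) y =
      ((fderiv ℝ (chartForm x₀) y).flip v).flip w := by
    intro v w
    have h1 := ((isMetricOn_chartForm x₀).hasFDerivAt hy)
    have h2 := (h1.clm_apply (hasFDerivAt_const v y)).clm_apply (hasFDerivAt_const w y)
    rw [show (fun y' => chartMetric x₀ y' v w) = fun y' => chartForm x₀ y' v w from rfl, h2.fderiv]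
    ext z
    simp
  rw [christoffelForm_apply, chartChristoffel, h, h]
  simp only [ContinuousLinearMap.flip_apply]
  ring

end Chart

end RadialConvexity

end

noncomputable section

namespace RadialConvexity

/-! ### Comparison of a metric at nearby points. -/

section MetricComparison

open scoped Topology

variable {E : Type*} [NormedAddCommGroup E] [NormedSpace ℝ E] [FiniteDimensional ℝ E]

set_option synthInstance.maxHeartbeats 400000
set_option synthInstance.maxSize 1000

attribute [local instance] instNormedAddCommGroupForm₁ instNormedSpaceForm₁
  instNormedAddCommGroupForm₂ instNormedSpaceForm₂ instNormedAddCommGroupForm₃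
  instNormedSpaceForm₃

namespace IsMetricOn

variable {B : E → E →L[ℝ] E →L[ℝ] ℝ} {U : Set E}

/-- The constant is the minimum of the quadratic form on the compact unit sphere; homogeneity does
the rest. -/
lemma exists_pos_mul_sq_norm_le (hB : IsMetricOn B U) {y : E} (hy : y ∈ U) :
    ∃ c > 0, ∀ v, c * ‖v‖ ^ 2 ≤ B y v v := by
  rcases subsingleton_or_nontrivial E with hE | hE
  · exact ⟨1, one_pos, fun v => by simp [Subsingleton.elim v 0]⟩
  obtain ⟨v₀, hv₀, hmin⟩ := (isCompact_sphere (0 : E) 1).exists_isMinOn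
    (NormedSpace.sphere_nonempty.2 zero_le_one) (f := fun v => B y v v)
    (((B y).continuous.clm_apply continuous_id).continuousOn)
  have hv₀' : v₀ ≠ 0 := ne_zero_of_mem_unit_sphere ⟨v₀, hv₀⟩
  refine ⟨B y v₀ v₀, hB.pos y hy v₀ hv₀', fun v => ?_⟩
  rcases eq_or_ne v 0 with rfl | hv
  · simp
  have hn : ‖v‖ ≠ 0 := norm_ne_zero_iff.2 hv
  have h1 : B y v₀ v₀ ≤ B y (‖v‖⁻¹ • v) (‖v‖⁻¹ • v) :=
    hmin (by simp [norm_smul, hn])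
  simp only [map_smul, smul_apply, smul_eq_mul] at h1
  calc B y v₀ v₀ * ‖v‖ ^ 2 ≤ (‖v‖⁻¹ * (‖v‖⁻¹ * B y v v)) * ‖v‖ ^ 2 := by gcongr
    _ = B y v v := by field_simp

lemma eventually_comparison (hB : IsMetricOn B U) {y₀ : E} (hy₀ : y₀ ∈ U) {D : ℝ} (hD : 1 < D) :
    ∀ᶠ y in 𝓝 y₀, ∀ v, B y₀ v v ≤ D * B y v v ∧ B y v v ≤ D * B y₀ v v := by
  obtain ⟨c, hc, hcv⟩ := hB.exists_pos_mul_sq_norm_le hy₀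
  have hε : 0 < 1 - D⁻¹ := sub_pos.2 (inv_lt_one_of_one_lt₀ hD)
  have hcont : ContinuousAt B y₀ := hB.continuousOn.continuousAt (hB.isOpen.mem_nhds hy₀)
  -- With this radius the error is at most `(1 - D⁻¹) B y₀ v v`. One bound follows directly, the
  -- other from `2 - D⁻¹ ≤ D`.
  filter_upwards [hcont (Metric.ball_mem_nhds _ (mul_pos hε hc))] with y hy v
  have hy' : ‖B y - B y₀‖ < (1 - D⁻¹) * c := by simpa [dist_eq_norm] using hy
  have h1 : |B y v v - B y₀ v v| ≤ (1 - D⁻¹) * B y₀ v v := by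
    have h2 := (B y - B y₀).le_opNorm₂ v v
    rw [Real.norm_eq_abs] at h2
    calc |B y v v - B y₀ v v| ≤ ‖B y - B y₀‖ * ‖v‖ * ‖v‖ := h2
      _ ≤ ((1 - D⁻¹) * c) * ‖v‖ * ‖v‖ := by gcongr
      _ = (1 - D⁻¹) * (c * ‖v‖ ^ 2) := by ring
      _ ≤ _ := by gcongr; exact hcv v
  have h0 := hB.nonneg hy₀ v
  have hD0 : 0 < D := by linarith
  obtain ⟨h2, h3⟩ := abs_le.1 h1
  constructor
  · have : D⁻¹ * B y₀ v v ≤ B y v v := by linarith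
    calc B y₀ v v = D * (D⁻¹ * B y₀ v v) := by field_simp
      _ ≤ _ := by gcongr
  · have h4 : 2 - D⁻¹ ≤ D := by
      have : D + D⁻¹ - 2 = (D - 1) ^ 2 * D⁻¹ := by field_simp; ring
      have h5 : 0 ≤ (D - 1) ^ 2 * D⁻¹ := by positivity
      linarith
    calc B y v v ≤ (2 - D⁻¹) * B y₀ v v := by linarith
      _ ≤ _ := by gcongr

end IsMetricOn

end MetricComparison

/-! ### Lengths of curves in a chart. -/

section Length

open MeasureTheory
open scoped ENNReal NNReal Topology

variable {E : Type*} [NormedAddCommGroup E] [NormedSpace ℝ E]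
  {M : Type*} [TopologicalSpace M] [ChartedSpace E M]
  [RiemannianBundle (fun x : M => TangentSpace 𝓘(ℝ, E) x)]

set_option synthInstance.maxHeartbeats 400000
set_option synthInstance.maxSize 1000

lemma norm_tangentSpace_congr {p q : M} (h : p = q) (v : E) :
    norm (E := TangentSpace 𝓘(ℝ, E) p) v = norm (E := TangentSpace 𝓘(ℝ, E) q) v := by
  subst h; rfl

variable [IsManifold 𝓘(ℝ, E) ∞ M]

/-- By the chain rule the coordinate velocity is the image of the velocity under the derivative of
the chart, and the derivative of the inverse chart undoes this. -/
lemma norm_mfderivWithin_eq_chartNorm (x₀ : M) {γ : ℝ → M} {s : Set ℝ} {t : ℝ}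
    (hγ : MDifferentiableWithinAt 𝓘(ℝ, ℝ) 𝓘(ℝ, E) γ s t) (hs : UniqueDiffWithinAt ℝ s t)
    (hsrc : γ t ∈ (extChartAt 𝓘(ℝ, E) x₀).source) :
    ‖(mfderivWithin 𝓘(ℝ, ℝ) 𝓘(ℝ, E) γ s t (1 : ℝ) : TangentSpace 𝓘(ℝ, E) (γ t))‖ =
      chartNorm x₀ (extChartAt 𝓘(ℝ, E) x₀ (γ t))
        (derivWithin (fun r => extChartAt 𝓘(ℝ, E) x₀ (γ r)) s t) := by
  have hsrc' : γ t ∈ (chartAt E x₀).source := by simpa using hsrc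
  have h1 : mfderivWithin 𝓘(ℝ, ℝ) 𝓘(ℝ, E) (extChartAt 𝓘(ℝ, E) x₀ ∘ γ) s t =
      (mfderiv 𝓘(ℝ, E) 𝓘(ℝ, E) (extChartAt 𝓘(ℝ, E) x₀) (γ t)).comp
        (mfderivWithin 𝓘(ℝ, ℝ) 𝓘(ℝ, E) γ s t) :=
    mfderiv_comp_mfderivWithin _ (mdifferentiableAt_extChartAt hsrc') hγ
      (uniqueMDiffWithinAt_iff_uniqueDiffWithinAt.2 hs)
  have h2 : derivWithin (fun r => extChartAt 𝓘(ℝ, E) x₀ (γ r)) s t =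
      mfderiv 𝓘(ℝ, E) 𝓘(ℝ, E) (extChartAt 𝓘(ℝ, E) x₀) (γ t)
        (mfderivWithin 𝓘(ℝ, ℝ) 𝓘(ℝ, E) γ s t (1 : ℝ)) := by
    rw [mfderivWithin_eq_fderivWithin] at h1
    exact congr($h1 (1 : ℝ))
  have h3 := mfderivWithin_extChartAt_symm_comp_mfderiv_extChartAt' (I := 𝓘(ℝ, E)) hsrc
  rw [mfderivWithin_of_mem_nhds (by simp)] at h3
  have h4 : mfderiv 𝓘(ℝ, E) 𝓘(ℝ, E) (extChartAt 𝓘(ℝ, E) x₀).symm (extChartAt 𝓘(ℝ, E) x₀ (γ t))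
      (mfderiv 𝓘(ℝ, E) 𝓘(ℝ, E) (extChartAt 𝓘(ℝ, E) x₀) (γ t)
        (mfderivWithin 𝓘(ℝ, ℝ) 𝓘(ℝ, E) γ s t (1 : ℝ))) =
      mfderivWithin 𝓘(ℝ, ℝ) 𝓘(ℝ, E) γ s t (1 : ℝ) :=
    congr($h3 (mfderivWithin 𝓘(ℝ, ℝ) 𝓘(ℝ, E) γ s t (1 : ℝ)))
  unfold chartNorm
  erw [h2, h4]
  exact norm_tangentSpace_congr (E := E)
    ((extChartAt 𝓘(ℝ, E) x₀).left_inv hsrc).symm _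

lemma enorm_mfderivWithin_eq_chartNorm (x₀ : M) {γ : ℝ → M} {s : Set ℝ} {t : ℝ}
    (hγ : MDifferentiableWithinAt 𝓘(ℝ, ℝ) 𝓘(ℝ, E) γ s t) (hs : UniqueDiffWithinAt ℝ s t)
    (hsrc : γ t ∈ (extChartAt 𝓘(ℝ, E) x₀).source) :
    ‖(mfderivWithin 𝓘(ℝ, ℝ) 𝓘(ℝ, E) γ s t (1 : ℝ) : TangentSpace 𝓘(ℝ, E) (γ t))‖ₑ =
      ENNReal.ofReal (chartNorm x₀ (extChartAt 𝓘(ℝ, E) x₀ (γ t))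
        (derivWithin (fun r => extChartAt 𝓘(ℝ, E) x₀ (γ r)) s t)) := by
  rw [← norm_mfderivWithin_eq_chartNorm x₀ hγ hs hsrc]
  exact (ofReal_norm (E := TangentSpace 𝓘(ℝ, E) (γ t)) _).symm

/-- The distance of two points is at most the length of the coordinate segment between them. -/
lemma riemannianEDist_symm_le (x₀ : M) {V : Set E} (hV : Convex ℝ V)
    (hVt : V ⊆ (extChartAt 𝓘(ℝ, E) x₀).target) {y z : E} (hy : y ∈ V) (hz : z ∈ V) {c : ℝ}
    (hc : ∀ p ∈ V, chartNorm x₀ p (z - y) ≤ c) :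
    riemannianEDist 𝓘(ℝ, E) ((extChartAt 𝓘(ℝ, E) x₀).symm y) ((extChartAt 𝓘(ℝ, E) x₀).symm z) ≤
      ENNReal.ofReal c := by
  set e := extChartAt 𝓘(ℝ, E) x₀ with he
  let η : ℝ → E := fun t => y + t • (z - y)
  have hη : ∀ t ∈ Icc (0 : ℝ) 1, η t ∈ V := fun t ht => hV.add_smul_sub_mem hy hz ht
  have hηd : ∀ t, HasDerivAt η (z - y) t := fun t => by
    simpa [η] using (((hasDerivAt_id t).smul_const (z - y)).const_add y)
  have hηs : ContMDiffOn 𝓘(ℝ, ℝ) 𝓘(ℝ, E) 1 η (Icc 0 1) := by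
    rw [contMDiffOn_iff_contDiffOn]
    have : ContDiff ℝ 1 η := by fun_prop
    exact this.contDiffOn
  let γ : ℝ → M := e.symm ∘ η
  have hγ : ContMDiffOn 𝓘(ℝ, ℝ) 𝓘(ℝ, E) 1 γ (Icc 0 1) :=
    (contMDiffOn_extChartAt_symm x₀).comp hηs fun t ht => hVt (hη t ht)
  have hle := riemannianEDist_le_pathELength hγ (x := e.symm y) (y := e.symm z)
    (by simp [γ, η]) (by simp [γ, η]) zero_le_one
  refine hle.trans ?_
  rw [pathELength_eq_lintegral_mfderivWithin_Icc]
  have hud := uniqueDiffOn_Icc (zero_lt_one' ℝ)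
  calc ∫⁻ t in Icc (0 : ℝ) 1, ‖mfderivWithin 𝓘(ℝ, ℝ) 𝓘(ℝ, E) γ (Icc 0 1) t (1 : ℝ)‖ₑ
      ≤ ∫⁻ _ in Icc (0 : ℝ) 1, ENNReal.ofReal c := by
        refine setLIntegral_mono' measurableSet_Icc fun t ht => ?_
        have hsrc : γ t ∈ e.source := e.map_target (hVt (hη t ht))
        rw [enorm_mfderivWithin_eq_chartNorm x₀ ((hγ t ht).mdifferentiableWithinAt one_ne_zero)
          (hud t ht) hsrc]
        have heq : ∀ r ∈ Icc (0 : ℝ) 1, e (γ r) = η r := fun r hr =>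
          e.right_inv (hVt (hη r hr))
        rw [← he, derivWithin_congr heq (heq t ht), heq t ht,
          (hηd t).hasDerivWithinAt.derivWithin (hud t ht)]
        exact ENNReal.ofReal_le_ofReal (hc _ (hη t ht))
    _ = ENNReal.ofReal c := by simp

variable [FiniteDimensional ℝ E]

/-- The coordinate displacement along a curve is bounded by its length. -/
lemma ofReal_chartNorm_sub_le (x₀ : M) {γ : ℝ → M}
    (hγ : ContMDiffOn 𝓘(ℝ, ℝ) 𝓘(ℝ, E) 1 γ (Icc 0 1)) (y₀ : E) {C : ℝ} (hC : 0 ≤ C)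
    (hsrc : ∀ t ∈ Icc (0 : ℝ) 1, γ t ∈ (extChartAt 𝓘(ℝ, E) x₀).source)
    (hcomp : ∀ t ∈ Icc (0 : ℝ) 1, ∀ v,
      chartNorm x₀ y₀ v ≤ C * chartNorm x₀ (extChartAt 𝓘(ℝ, E) x₀ (γ t)) v) :
    ENNReal.ofReal (chartNorm x₀ y₀
        (extChartAt 𝓘(ℝ, E) x₀ (γ 1) - extChartAt 𝓘(ℝ, E) x₀ (γ 0))) ≤
      ENNReal.ofReal C * pathELength 𝓘(ℝ, E) γ 0 1 := by
  set e := extChartAt 𝓘(ℝ, E) x₀ with he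
  set d := e (γ 1) - e (γ 0) with hd
  set N := chartNorm x₀ y₀ d with hN
  have hN0 : 0 ≤ N := chartNorm_nonneg x₀ y₀ d
  rcases hN0.eq_or_lt with h0 | hNpos
  · simp [← h0]
  -- Pairing with the displacement `d` reduces the claim to a real function: `ℓ d = N²`, while `|ℓ
  -- v| ≤ N · chartNorm x₀ y₀ v` by Cauchy-Schwarz. One factor `N` is cancelled at the end.
  let ℓ : E →L[ℝ] ℝ := chartForm x₀ y₀ d
  have hud := uniqueDiffOn_Icc (zero_lt_one' ℝ)
  have hu : ContDiffOn ℝ 1 (fun t => e (γ t)) (Icc 0 1) := by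
    rw [← contMDiffOn_iff_contDiffOn]
    exact (contMDiffOn_extChartAt (I := 𝓘(ℝ, E)) (x := x₀)).comp hγ
      fun t ht => by simpa [he] using hsrc t ht
  have hg : ContDiffOn ℝ 1 (fun t => ℓ (e (γ t))) (Icc 0 1) := ℓ.contDiff.comp_contDiffOn hu
  have h1 := enorm_sub_le_lintegral_derivWithin_Icc_of_contDiffOn_Icc hg zero_le_one
  have h2 : ‖ℓ (e (γ 1)) - ℓ (e (γ 0))‖ₑ = ENNReal.ofReal N * ENNReal.ofReal N := by
    rw [← map_sub, ← hd, show ℓ d = N * N by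
      rw [← sq, hN, ← chartMetric_self]; rfl, ← ENNReal.ofReal_mul hN0,
      Real.enorm_eq_ofReal (mul_nonneg hN0 hN0)]
  have h3 : ∫⁻ t in Icc (0 : ℝ) 1, ‖derivWithin (fun t => ℓ (e (γ t))) (Icc 0 1) t‖ₑ ≤
      ENNReal.ofReal N * (ENNReal.ofReal C * pathELength 𝓘(ℝ, E) γ 0 1) := by
    rw [pathELength_eq_lintegral_mfderivWithin_Icc, ← mul_assoc,
      ← lintegral_const_mul' _ _ (ENNReal.mul_ne_top ENNReal.ofReal_ne_top ENNReal.ofReal_ne_top)]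
    refine setLIntegral_mono' measurableSet_Icc fun t ht => ?_
    change _ ≤ _ * ‖(mfderivWithin 𝓘(ℝ, ℝ) 𝓘(ℝ, E) γ (Icc 0 1) t (1 : ℝ) :
      TangentSpace 𝓘(ℝ, E) (γ t))‖ₑ
    rw [enorm_mfderivWithin_eq_chartNorm x₀ ((hγ t ht).mdifferentiableWithinAt one_ne_zero)
      (hud t ht) (hsrc t ht), ← he]
    have hut : HasDerivWithinAt (fun t => e (γ t)) (derivWithin (fun t => e (γ t)) (Icc 0 1) t)
        (Icc 0 1) t := ((hu.differentiableOn one_ne_zero) t ht).hasDerivWithinAt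
    have h4 := (ℓ.hasFDerivAt.comp_hasDerivWithinAt t hut).derivWithin (hud t ht)
    change derivWithin (fun t => ℓ (e (γ t))) (Icc 0 1) t = _ at h4
    rw [h4, Real.enorm_eq_ofReal_abs, ← ENNReal.ofReal_mul hN0,
      ← ENNReal.ofReal_mul (mul_nonneg hN0 hC)]
    apply ENNReal.ofReal_le_ofReal
    refine (abs_chartMetric_le x₀ y₀ d _).trans ?_
    rw [mul_assoc]
    gcongr
    exact hcomp t ht _
  rw [h2] at h1
  exact (ENNReal.mul_le_mul_iff_right (by simpa using hNpos) ENNReal.ofReal_ne_top).1 (h1.trans h3)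

end Length

end RadialConvexity

end

noncomputable section

namespace RadialConvexity

/-! ### Speeds as limits of difference quotients. -/

section Slope

open scoped Topology

variable {E : Type*} [NormedAddCommGroup E] [NormedSpace ℝ E] {N : E → ℝ} {f : ℝ → E} {f' : E}
  {t : ℝ}

lemma tendsto_seminorm_slope (hNc : Continuous N) (hNs : ∀ (c : ℝ) v, N (c • v) = |c| * N v)
    (hf : HasDerivAt f f' t) :
    Filter.Tendsto (fun s => |s - t|⁻¹ * N (f s - f t)) (𝓝[≠] t) (𝓝 (N f')) := by
  refine ((hNc.tendsto f').comp (hasDerivAt_iff_tendsto_slope.1 hf)).congr fun s => ?_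
  simp [slope, hNs, abs_inv]

lemma seminorm_deriv_le (hNc : Continuous N) (hNs : ∀ (c : ℝ) v, N (c • v) = |c| * N v)
    (hf : HasDerivAt f f' t) {K : ℝ} (h : ∀ᶠ s in 𝓝 t, N (f s - f t) ≤ K * |s - t|) :
    N f' ≤ K := by
  refine le_of_tendsto (tendsto_seminorm_slope hNc hNs hf) ?_
  filter_upwards [nhdsWithin_le_nhds h, self_mem_nhdsWithin] with s hs hst
  have : 0 < |s - t| := abs_pos.2 (sub_ne_zero.2 hst)
  rw [inv_mul_le_iff₀ this]
  linarith

/-- The inequality between increments is divided by `|s - t|` and passed to the limit. -/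
lemma abs_deriv_le_seminorm_deriv (hNc : Continuous N)
    (hNs : ∀ (c : ℝ) v, N (c • v) = |c| * N v) (hf : HasDerivAt f f' t) {g : ℝ → ℝ} {g' : ℝ}
    (hg : HasDerivAt g g' t) {C : ℝ} (h : ∀ᶠ s in 𝓝 t, |g s - g t| ≤ C * N (f s - f t)) :
    |g'| ≤ C * N f' := by
  have hg2 := tendsto_seminorm_slope (N := fun x : ℝ => |x|) continuous_abs
    (fun c v => by simp [abs_mul]) hg
  refine le_of_tendsto_of_tendsto hg2 ((tendsto_seminorm_slope hNc hNs hf).const_mul C) ?_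
  filter_upwards [nhdsWithin_le_nhds h] with s hs
  calc |s - t|⁻¹ * |g s - g t| ≤ |s - t|⁻¹ * (C * N (f s - f t)) := by gcongr
    _ = _ := by ring

end Slope

/-! ### Integrability of the energy density. -/

section Energy

open MeasureTheory
open scoped NNReal Topology

variable {E : Type*} [NormedAddCommGroup E] [NormedSpace ℝ E] [FiniteDimensional ℝ E]

set_option synthInstance.maxHeartbeats 400000
set_option synthInstance.maxSize 1000

attribute [local instance] instNormedAddCommGroupForm₁ instNormedSpaceForm₁
  instNormedAddCommGroupForm₂ instNormedSpaceForm₂ instNormedAddCommGroupForm₃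
  instNormedSpaceForm₃

lemma IsMetricOn.intervalIntegrable_energy {B : E → E →L[ℝ] E →L[ℝ] ℝ} {U : Set E}
    (hB : IsMetricOn B U) {a b : ℝ} (hab : a ≤ b) {u : ℝ → E} {K : ℝ≥0}
    (hu : LipschitzOnWith K u (Icc a b)) (huU : MapsTo u (Icc a b) U) :
    IntervalIntegrable (fun t => B (u t) (deriv u t) (deriv u t)) volume a b := by
  let : MeasurableSpace E := borel E
  have : BorelSpace E := ⟨rfl⟩
  have hvm : AEStronglyMeasurable (deriv u) (volume.restrict (Icc a b)) :=
    (measurable_deriv u).aestronglyMeasurable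
  have hBc := hB.continuousOn.comp hu.continuousOn huU
  obtain ⟨C, hC⟩ := isCompact_Icc.exists_bound_of_continuousOn hBc
  have hC0 : 0 ≤ C := (norm_nonneg _).trans (hC a (left_mem_Icc.2 hab))
  refine intervalIntegrable_of_ae_norm_le (C := C * K * K) hab (aestronglyMeasurable_clm_apply
    (aestronglyMeasurable_clm_apply (hBc.aestronglyMeasurable measurableSet_Icc) hvm) hvm) ?_
  filter_upwards [ae_norm_deriv_le_of_lipschitzOnWith hu] with t h1 ht
  refine ((B _).le_opNorm₂ _ _).trans ?_
  have := h1 ht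
  gcongr
  exact hC t ht

end Energy

/-! ### Riemannian distance versus chart norms. -/

section LocalDistance

open MeasureTheory
open scoped ENNReal NNReal Topology

variable {E : Type*} [NormedAddCommGroup E] [NormedSpace ℝ E] [FiniteDimensional ℝ E]
  {M : Type*} [MetricSpace M] [ChartedSpace E M] [IsManifold 𝓘(ℝ, E) ∞ M]
  [RiemannianBundle (fun x : M => TangentSpace 𝓘(ℝ, E) x)]
  [IsContMDiffRiemannianBundle 𝓘(ℝ, E) ∞ E (fun x : M => TangentSpace 𝓘(ℝ, E) x)]

set_option synthInstance.maxHeartbeats 400000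
set_option synthInstance.maxSize 1000

omit [IsManifold 𝓘(ℝ, E) ∞ M]
  [IsContMDiffRiemannianBundle 𝓘(ℝ, E) ∞ E (fun x : M => TangentSpace 𝓘(ℝ, E) x)] in
lemma continuous_chartNorm (x₀ : M) (y : E) : Continuous (chartNorm x₀ y) := by
  have h : chartNorm x₀ y = fun v => √(chartForm x₀ y v v) := by
    ext v; exact chartNorm_eq_sqrt x₀ y v
  rw [h]
  exact ((chartForm x₀ y).continuous.clm_apply continuous_id).sqrt

omit [IsManifold 𝓘(ℝ, E) ∞ M]
  [IsContMDiffRiemannianBundle 𝓘(ℝ, E) ∞ E (fun x : M => TangentSpace 𝓘(ℝ, E) x)] in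
lemma chartNorm_smul (x₀ : M) (y : E) (c : ℝ) (v : E) :
    chartNorm x₀ y (c • v) = |c| * chartNorm x₀ y v := by
  have h : chartMetric x₀ y (c • v) (c • v) = c ^ 2 * chartMetric x₀ y v v := by
    simp only [← chartForm_apply, map_smul, smul_apply, smul_eq_mul]; ring
  rw [chartNorm_eq_sqrt, h, Real.sqrt_mul (sq_nonneg c), Real.sqrt_sq_eq_abs, ← chartNorm_eq_sqrt]

lemma eventually_chartNorm_comparison (x₀ : M) {y₀ : E}
    (hy₀ : y₀ ∈ (extChartAt 𝓘(ℝ, E) x₀).target) {C : ℝ} (hC : 1 < C) :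
    ∀ᶠ y in 𝓝 y₀, ∀ v, chartNorm x₀ y₀ v ≤ C * chartNorm x₀ y v ∧
      chartNorm x₀ y v ≤ C * chartNorm x₀ y₀ v := by
  have hC0 : 0 ≤ C := by linarith
  filter_upwards [(isMetricOn_chartForm x₀).eventually_comparison hy₀ (D := C ^ 2)
    (one_lt_pow₀ hC two_ne_zero)] with y hy v
  have h := hy v
  simp only [chartForm_apply, chartMetric_self, ← mul_pow] at h
  exact ⟨le_of_sq_le_sq h.1 (mul_nonneg hC0 (chartNorm_nonneg _ _ _)),
    le_of_sq_le_sq h.2 (mul_nonneg hC0 (chartNorm_nonneg _ _ _))⟩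

omit [IsManifold 𝓘(ℝ, E) ∞ M] in
lemma exists_chartNorm_le (x₀ : M) (y₀ : E) : ∃ C > 0, ∀ v, chartNorm x₀ y₀ v ≤ C * ‖v‖ := by
  refine ⟨√‖chartForm x₀ y₀‖ + 1, by positivity, fun v => ?_⟩
  have h := (le_abs_self _).trans ((chartForm x₀ y₀).le_opNorm₂ v v)
  rw [chartForm_apply] at h
  calc chartNorm x₀ y₀ v ≤ √(‖chartForm x₀ y₀‖ * ‖v‖ * ‖v‖) := by
        rw [chartNorm_eq_sqrt]; exact Real.sqrt_le_sqrt h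
    _ = √‖chartForm x₀ y₀‖ * ‖v‖ := by
        rw [mul_assoc, Real.sqrt_mul' _ (mul_self_nonneg _), Real.sqrt_mul_self (norm_nonneg _)]
    _ ≤ _ := by gcongr; linarith

lemma exists_norm_le_chartNorm (x₀ : M) {y₀ : E} (hy₀ : y₀ ∈ (extChartAt 𝓘(ℝ, E) x₀).target) :
    ∃ C > 0, ∀ v, ‖v‖ ≤ C * chartNorm x₀ y₀ v := by
  obtain ⟨c, hc, hcv⟩ := (isMetricOn_chartForm x₀).exists_pos_mul_sq_norm_le hy₀
  refine ⟨(√c)⁻¹, by positivity, fun v => ?_⟩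
  rw [le_inv_mul_iff₀ (by positivity), chartNorm_eq_sqrt]
  refine Real.le_sqrt_of_sq_le ?_
  rw [mul_pow, Real.sq_sqrt hc.le]
  exact hcv v

variable [IsRiemannianManifold 𝓘(ℝ, E) M]

/-- Near a point, the distance is bounded by the norm at that point, up to a factor `C > 1`. -/
lemma exists_dist_symm_le (x₀ : M) {y₀ : E} (hy₀ : y₀ ∈ (extChartAt 𝓘(ℝ, E) x₀).target) {C : ℝ}
    (hC : 1 < C) : ∃ r > 0, Metric.ball y₀ r ⊆ (extChartAt 𝓘(ℝ, E) x₀).target ∧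
      ∀ y ∈ Metric.ball y₀ r, ∀ z ∈ Metric.ball y₀ r,
        dist ((extChartAt 𝓘(ℝ, E) x₀).symm y) ((extChartAt 𝓘(ℝ, E) x₀).symm z) ≤
          C * chartNorm x₀ y₀ (z - y) := by
  obtain ⟨r, hr, hball⟩ := Metric.mem_nhds_iff.1 (Filter.inter_mem
    ((isOpen_extChartAt_target (I := 𝓘(ℝ, E)) x₀).mem_nhds hy₀)
    (eventually_chartNorm_comparison x₀ hy₀ hC))
  refine ⟨r, hr, fun y hy => (hball hy).1, fun y hy z hz => ?_⟩
  have h := riemannianEDist_symm_le x₀ (convex_ball y₀ r) (fun y hy => (hball hy).1) hy hz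
    (c := C * chartNorm x₀ y₀ (z - y)) fun p hp => ((hball hp).2 _).2
  rw [← IsRiemannianManifold.out (I := 𝓘(ℝ, E)), edist_dist] at h
  exact (ENNReal.ofReal_le_ofReal_iff
    (mul_nonneg (by linarith) (chartNorm_nonneg _ _ _))).1 h

/-- Near a point, the norm at that point is bounded by the distance, up to a factor `C > 1`. -/
lemma exists_chartNorm_sub_le_dist (x₀ : M) {x : M}
    (hx : x ∈ (extChartAt 𝓘(ℝ, E) x₀).source) {C : ℝ} (hC : 1 < C) :
    ∃ W ∈ 𝓝 x, W ⊆ (extChartAt 𝓘(ℝ, E) x₀).source ∧ ∀ p ∈ W, ∀ q ∈ W,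
      chartNorm x₀ (extChartAt 𝓘(ℝ, E) x₀ x)
        (extChartAt 𝓘(ℝ, E) x₀ q - extChartAt 𝓘(ℝ, E) x₀ p) ≤ C * dist p q := by
  set e := extChartAt 𝓘(ℝ, E) x₀ with he
  have hC0 : 0 ≤ C := by linarith
  have hcont : ContinuousAt e x := continuousAt_extChartAt' hx
  have hsrc : e.source ∈ 𝓝 x := (isOpen_extChartAt_source x₀).mem_nhds hx
  obtain ⟨ρ, hρ, hball⟩ := Metric.mem_nhds_iff.1 (Filter.inter_mem hsrc
    (hcont (eventually_chartNorm_comparison x₀ (e.map_source hx) hC)))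
  -- Points within `ρ / 4` of `x` are joined by curves of length less than `3 * ρ / 4`, arbitrarily
  -- close to their distance, and such curves stay in the ball of radius `ρ`.
  refine ⟨Metric.ball x (ρ / 4), Metric.ball_mem_nhds _ (by positivity),
    fun p hp => (hball (Metric.ball_subset_ball (by linarith) hp)).1, fun p hp q hq => ?_⟩
  rw [Metric.mem_ball] at hp hq
  have hpq : dist p q < ρ / 2 := by linarith [dist_triangle_right p q x]
  refine le_of_forall_pos_le_add fun ε hε => ?_
  set r : ℝ := min (dist p q + ε / C) (3 * ρ / 4) with hr
  have hεC : 0 < ε / C := by positivity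
  have hdr : dist p q < r := lt_min (by linarith) (by linarith)
  have hr0 : 0 < r := dist_nonneg.trans_lt hdr
  have hlt : riemannianEDist 𝓘(ℝ, E) p q < ENNReal.ofReal r := by
    rw [← IsRiemannianManifold.out (I := 𝓘(ℝ, E)), edist_dist]
    exact (ENNReal.ofReal_lt_ofReal_iff hr0).2 hdr
  obtain ⟨γ, hγ0, hγ1, hγ, hlen⟩ := exists_lt_of_riemannianEDist_lt hlt
  have hmem : ∀ t ∈ Icc (0 : ℝ) 1, γ t ∈ Metric.ball x ρ := by
    intro t ht
    have h1 : edist p (γ t) ≤ ENNReal.ofReal r := by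
      rw [IsRiemannianManifold.out (I := 𝓘(ℝ, E))]
      exact (riemannianEDist_le_pathELength (hγ.mono (Icc_subset_Icc_right ht.2)) hγ0 rfl
        ht.1).trans ((pathELength_mono le_rfl ht.2).trans hlen.le)
    rw [edist_dist, ENNReal.ofReal_le_ofReal_iff hr0.le] at h1
    have h2 : r ≤ 3 * ρ / 4 := min_le_right _ _
    rw [Metric.mem_ball]
    linarith [dist_triangle_left (γ t) x p]
  have h := ofReal_chartNorm_sub_le x₀ hγ (e x) hC0 (fun t ht => (hball (hmem t ht)).1)
    fun t ht v => ((hball (hmem t ht)).2 v).1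
  rw [hγ0, hγ1] at h
  have h' : ENNReal.ofReal (chartNorm x₀ (e x) (e q - e p)) ≤ ENNReal.ofReal (C * r) := by
    rw [ENNReal.ofReal_mul hC0]
    exact h.trans (by gcongr)
  rw [ENNReal.ofReal_le_ofReal_iff (by positivity)] at h'
  calc _ ≤ C * r := h'
    _ ≤ C * (dist p q + ε / C) := by gcongr; exact min_le_left _ _
    _ = C * dist p q + ε := by field_simp

end LocalDistance

end RadialConvexity

end

noncomputable section

namespace RadialConvexity

/-! ### Curves of constant metric speed minimize the energy in charts. -/

section MetricGeodesic

open MeasureTheory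
open scoped ENNReal NNReal Topology

variable {E : Type*} [NormedAddCommGroup E] [NormedSpace ℝ E] [FiniteDimensional ℝ E]
  {M : Type*} [MetricSpace M] [ChartedSpace E M] [IsManifold 𝓘(ℝ, E) ∞ M]
  [RiemannianBundle (fun x : M => TangentSpace 𝓘(ℝ, E) x)]
  [IsContMDiffRiemannianBundle 𝓘(ℝ, E) ∞ E (fun x : M => TangentSpace 𝓘(ℝ, E) x)]
  [IsRiemannianManifold 𝓘(ℝ, E) M]

set_option synthInstance.maxHeartbeats 400000
set_option synthInstance.maxSize 1000

/-- The speed of a curve in a chart bounds the rate of change of the distance to a point. -/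
lemma abs_deriv_dist_le (x₀ : M) {v : ℝ → E} {v' : E} {t : ℝ} (hv : HasDerivAt v v' t)
    (ht : v t ∈ (extChartAt 𝓘(ℝ, E) x₀).target) (p : M) {d' : ℝ}
    (hd : HasDerivAt (fun s => dist p ((extChartAt 𝓘(ℝ, E) x₀).symm (v s))) d' t) :
    |d'| ≤ chartNorm x₀ (v t) v' := by
  refine le_of_forall_gt_imp_ge_of_dense fun K hK => ?_
  by_contra! hlt
  have hN0 := chartNorm_nonneg x₀ (v t) v'
  obtain ⟨C, hC1, hCK⟩ : ∃ C > 1, C * chartNorm x₀ (v t) v' < K := by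
    have h1 : Filter.Tendsto (fun C : ℝ => C * chartNorm x₀ (v t) v') (𝓝[>] 1)
        (𝓝 (1 * chartNorm x₀ (v t) v')) :=
      (Filter.tendsto_id.mul_const _).mono_left nhdsWithin_le_nhds
    rw [one_mul] at h1
    obtain ⟨C, h2, h3⟩ := ((h1.eventually (gt_mem_nhds hK)).and self_mem_nhdsWithin).exists
    exact ⟨C, h3, h2⟩
  obtain ⟨r, hr, -, hball⟩ := exists_dist_symm_le x₀ ht hC1
  have h := abs_deriv_le_seminorm_deriv (continuous_chartNorm x₀ (v t)) (chartNorm_smul x₀ (v t))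
    hv hd (C := C) (by
      filter_upwards [hv.continuousAt (Metric.ball_mem_nhds _ hr)] with s hs
      have h1 := hball (v t) (Metric.mem_ball_self hr) (v s) hs
      refine le_trans ?_ h1
      rw [abs_le]
      have h2 := dist_triangle p ((extChartAt 𝓘(ℝ, E) x₀).symm (v s))
        ((extChartAt 𝓘(ℝ, E) x₀).symm (v t))
      have h3 := dist_triangle p ((extChartAt 𝓘(ℝ, E) x₀).symm (v t))
        ((extChartAt 𝓘(ℝ, E) x₀).symm (v s))
      rw [dist_comm ((extChartAt 𝓘(ℝ, E) x₀).symm (v s))] at h2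
      constructor <;> linarith)
  linarith

/-- The speed in a chart of a curve of constant metric speed `L` is at most `L`. -/
lemma chartNorm_deriv_le (x₀ : M) {γ : ℝ → M} {t L : ℝ}
    (hL : ∀ᶠ s in 𝓝 t, dist (γ t) (γ s) ≤ L * |s - t|)
    (hcont : ContinuousAt γ t)
    (hsrc : γ t ∈ (extChartAt 𝓘(ℝ, E) x₀).source) {u' : E}
    (hu : HasDerivAt (fun s => extChartAt 𝓘(ℝ, E) x₀ (γ s)) u' t) :
    chartNorm x₀ (extChartAt 𝓘(ℝ, E) x₀ (γ t)) u' ≤ L := by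
  have hL0 : 0 ≤ L := by
    have h1 : ∀ᶠ s in 𝓝[≠] t, dist (γ t) (γ s) ≤ L * |s - t| := nhdsWithin_le_nhds hL
    obtain ⟨s, hs, hst⟩ := (h1.and self_mem_nhdsWithin).exists
    have : 0 < |s - t| := abs_pos.2 (sub_ne_zero.2 hst)
    exact nonneg_of_mul_nonneg_left (dist_nonneg.trans hs) this
  have hC : ∀ C > 1, chartNorm x₀ (extChartAt 𝓘(ℝ, E) x₀ (γ t)) u' ≤ C * L := by
    intro C hC
    obtain ⟨W, hW, -, hdist⟩ := exists_chartNorm_sub_le_dist x₀ hsrc hC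
    refine seminorm_deriv_le (continuous_chartNorm x₀ _) (chartNorm_smul x₀ _) hu ?_
    filter_upwards [hL, hcont hW] with s h1 h2
    calc _ ≤ C * dist (γ t) (γ s) := hdist _ (mem_of_mem_nhds hW) _ h2
      _ ≤ C * (L * |s - t|) := by gcongr
      _ = C * L * |s - t| := by ring
  have h1 : Filter.Tendsto (fun C : ℝ => C * L) (𝓝[>] 1) (𝓝 (1 * L)) :=
    (Filter.tendsto_id.mul_const _).mono_left nhdsWithin_le_nhds
  rw [one_mul] at h1
  exact ge_of_tendsto h1 (by filter_upwards [self_mem_nhdsWithin] with C h using hC C h)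

/-- The energy of a curve in a chart which joins two points at distance `(b - a) L` is at least
`(b - a) L²`. -/
lemma le_integral_energy (x₀ : M) {a b L : ℝ} (hab : a ≤ b) {y₀ : E} {r K₁ : ℝ}
    (hball : Metric.ball y₀ r ⊆ (extChartAt 𝓘(ℝ, E) x₀).target)
    (hK₁ : 0 ≤ K₁) (hdist : ∀ y ∈ Metric.ball y₀ r, ∀ z ∈ Metric.ball y₀ r,
      dist ((extChartAt 𝓘(ℝ, E) x₀).symm y) ((extChartAt 𝓘(ℝ, E) x₀).symm z) ≤ K₁ * ‖z - y‖)
    {v : ℝ → E} {K : ℝ≥0} (hv : LipschitzOnWith K v (Icc a b))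
    (hvU : MapsTo v (Icc a b) (Metric.ball y₀ r))
    (hL : dist ((extChartAt 𝓘(ℝ, E) x₀).symm (v a)) ((extChartAt 𝓘(ℝ, E) x₀).symm (v b)) =
      (b - a) * L) :
    L ^ 2 * (b - a) ≤ ∫ t in a..b, chartForm x₀ (v t) (deriv v t) (deriv v t) := by
  set e := extChartAt 𝓘(ℝ, E) x₀ with he
  have hB := (isMetricOn_chartForm x₀).mono Metric.isOpen_ball hball
  set D : ℝ → ℝ := fun t => dist (e.symm (v a)) (e.symm (v t)) with hD
  have hDL : LipschitzOnWith (K₁.toNNReal * K) D (Icc a b) := by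
    apply LipschitzOnWith.of_dist_le_mul
    intro s hs t ht
    have h1 := hdist _ (hvU hs) _ (hvU ht)
    have h2 := hv.dist_le_mul t ht s hs
    rw [dist_eq_norm] at h2
    rw [NNReal.coe_mul, Real.coe_toNNReal _ hK₁, Real.dist_eq, mul_assoc, dist_comm s t]
    refine (abs_sub_le_iff.2 ⟨?_, ?_⟩).trans (h1.trans (by gcongr))
    · rw [dist_comm (e.symm (v s))]
      linarith [dist_triangle (e.symm (v a)) (e.symm (v t)) (e.symm (v s))]
    · linarith [dist_triangle (e.symm (v a)) (e.symm (v s)) (e.symm (v t))]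
  have hDac : AbsolutelyContinuousOnInterval D a b :=
    LipschitzOnWith.absolutelyContinuousOnInterval (by rwa [uIcc_of_le hab])
  have hint : ∫ t in a..b, deriv D t = (b - a) * L := by
    rw [hDac.integral_deriv_eq_sub]
    simp [hD, hL]
  have hDi : IntervalIntegrable (deriv D) volume a b := hDac.intervalIntegrable_deriv
  -- The pointwise inequality `2 L D' - L² ≤ D'²` stands in for Cauchy-Schwarz; `D'²` is in turn at
  -- most the energy density.
  have h1 : ∫ t in a..b, (2 * L * deriv D t - L ^ 2) = L ^ 2 * (b - a) := by
    rw [intervalIntegral.integral_sub (hDi.const_mul _) intervalIntegrable_const,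
      intervalIntegral.integral_const_mul, hint, intervalIntegral.integral_const, smul_eq_mul]
    ring
  rw [← h1]
  refine intervalIntegral.integral_mono_ae_restrict hab
    ((hDi.const_mul _).sub intervalIntegrable_const)
    (hB.intervalIntegrable_energy hab hv hvU) ?_
  rw [Filter.EventuallyLE, ae_restrict_iff' measurableSet_Icc]
  filter_upwards [ae_differentiableAt_of_lipschitzOnWith hab hv,
    ae_differentiableAt_of_lipschitzOnWith hab hDL] with t h2 h3 ht
  have h4 := abs_deriv_dist_le x₀ (h2 ht).hasDerivAt (hball (hvU ht)) _ (h3 ht).hasDerivAt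
  rw [chartForm_apply, chartMetric_self]
  have h5 : deriv D t ^ 2 ≤ chartNorm x₀ (v t) (deriv v t) ^ 2 := by
    rw [← sq_abs (deriv D t)]
    gcongr
  nlinarith [sq_nonneg (deriv D t - L)]

/-- In any chart, a curve of constant metric speed is locally of class `C²` and satisfies the
geodesic equation. -/
theorem exists_contDiffOn_and_geodesic_eq {γ : ℝ → M} {L : ℝ} (hL0 : 0 ≤ L)
    (hγ : ∀ s ∈ Icc (0 : ℝ) 1, ∀ t ∈ Icc (0 : ℝ) 1, dist (γ s) (γ t) = |s - t| * L)
    (x₀ : M) {t₀ : ℝ} (ht₀ : t₀ ∈ Icc (0 : ℝ) 1)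
    (hsrc : γ t₀ ∈ (extChartAt 𝓘(ℝ, E) x₀).source) :
    ∃ a b, a < b ∧ Icc a b ⊆ Icc 0 1 ∧ Icc a b ∈ 𝓝[Icc 0 1] t₀ ∧
      (∀ t ∈ Icc a b, γ t ∈ (extChartAt 𝓘(ℝ, E) x₀).source) ∧
      ContDiffOn ℝ 2 (fun t => extChartAt 𝓘(ℝ, E) x₀ (γ t)) (Icc a b) ∧
      ∀ t ∈ Icc a b, chartForm x₀ (extChartAt 𝓘(ℝ, E) x₀ (γ t))
          (derivWithin (derivWithin (fun t => extChartAt 𝓘(ℝ, E) x₀ (γ t)) (Icc a b)) (Icc a b) t)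
        + christoffelForm (chartForm x₀) (extChartAt 𝓘(ℝ, E) x₀ (γ t))
          (derivWithin (fun t => extChartAt 𝓘(ℝ, E) x₀ (γ t)) (Icc a b) t) = 0 := by
  set e := extChartAt 𝓘(ℝ, E) x₀ with he
  have hy₀ : e (γ t₀) ∈ e.target := e.map_source hsrc
  obtain ⟨r, hr, hball, hdist⟩ := exists_dist_symm_le x₀ hy₀ one_lt_two
  obtain ⟨W, hW, hWsrc, hWdist⟩ := exists_chartNorm_sub_le_dist x₀ hsrc one_lt_two
  obtain ⟨C₁, hC₁, hC₁'⟩ := exists_chartNorm_le x₀ (e (γ t₀))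
  obtain ⟨C₂, hC₂, hC₂'⟩ := exists_norm_le_chartNorm x₀ hy₀
  have hγc : ContinuousOn γ (Icc 0 1) := by
    have : LipschitzOnWith L.toNNReal γ (Icc 0 1) := by
      apply LipschitzOnWith.of_dist_le_mul
      intro s hs t ht
      rw [hγ s hs t ht, Real.coe_toNNReal _ hL0, Real.dist_eq, mul_comm]
    exact this.continuousOn
  have hP : γ ⁻¹' (W ∩ e ⁻¹' Metric.ball (e (γ t₀)) r) ∈ 𝓝[Icc 0 1] t₀ :=
    hγc t₀ ht₀ (Filter.inter_mem hW
      ((continuousAt_extChartAt' hsrc) (Metric.ball_mem_nhds _ hr)))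
  obtain ⟨δ, hδ, hδP⟩ := Metric.mem_nhdsWithin_iff.1 hP
  set a := max 0 (t₀ - δ / 2) with ha
  set b := min 1 (t₀ + δ / 2) with hb
  have hab : a < b := by
    refine max_lt (lt_min one_pos ?_) (lt_min ?_ ?_) <;> linarith [ht₀.1, ht₀.2]
  have hsub : Icc a b ⊆ Icc 0 1 := Icc_subset_Icc (le_max_left _ _) (min_le_left _ _)
  have hmem : ∀ t ∈ Icc a b, γ t ∈ W ∩ e ⁻¹' Metric.ball (e (γ t₀)) r := by
    intro t ht
    refine hδP ⟨?_, hsub ht⟩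
    rw [Metric.mem_ball, Real.dist_eq, abs_lt]
    have h1 := (le_max_right _ _).trans ht.1
    have h2 := ht.2.trans (min_le_right _ _)
    constructor <;> linarith
  have hnhds : Icc a b ∈ 𝓝[Icc 0 1] t₀ := by
    filter_upwards [self_mem_nhdsWithin,
      mem_nhdsWithin_of_mem_nhds (Icc_mem_nhds (by linarith : t₀ - δ / 2 < t₀)
        (by linarith : t₀ < t₀ + δ / 2))] with t h1 h2
    exact ⟨max_le h1.1 h2.1, le_min h1.2 h2.2⟩
  have htsrc : ∀ t ∈ Icc a b, γ t ∈ e.source := fun t ht => hWsrc (hmem t ht).1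
  set u : ℝ → E := fun t => e (γ t) with hu
  have huU : MapsTo u (Icc a b) (Metric.ball (e (γ t₀)) r) := fun t ht => (hmem t ht).2
  -- `L` is the metric speed, `2` compares distance with the chart norm at `γ t₀`, and `C₂` compares
  -- that with the norm of `E`.
  have huL : LipschitzOnWith (C₂ * (2 * L)).toNNReal u (Icc a b) := by
    apply LipschitzOnWith.of_dist_le_mul
    intro s hs t ht
    rw [Real.coe_toNNReal _ (by positivity), dist_comm, dist_eq_norm]
    refine (hC₂' _).trans ?_
    have h1 := hWdist _ (hmem s hs).1 _ (hmem t ht).1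
    rw [hγ s (hsub hs) t (hsub ht), ← Real.dist_eq] at h1
    calc C₂ * chartNorm x₀ (e (γ t₀)) (u t - u s) ≤ C₂ * (2 * (dist s t * L)) := by gcongr
      _ = _ := by ring
  have hB := (isMetricOn_chartForm x₀).mono Metric.isOpen_ball hball
  have hsymm : ∀ t ∈ Icc a b, e.symm (u t) = γ t := fun t ht => e.left_inv (htsrc t ht)
  have hLu : ∫ t in a..b, chartForm x₀ (u t) (deriv u t) (deriv u t) ≤ L ^ 2 * (b - a) := by
    have h1 : ∫ _ in a..b, L ^ 2 = L ^ 2 * (b - a) := by simp [mul_comm]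
    rw [← h1]
    refine intervalIntegral.integral_mono_ae_restrict hab.le
      (hB.intervalIntegrable_energy hab.le huL huU) intervalIntegrable_const ?_
    rw [Filter.EventuallyLE, ae_restrict_iff' measurableSet_Icc]
    have h2 : ∀ᵐ t, t ∈ Icc a b → t ∈ Ioo a b := ae_mem_Icc_imp_of_mem_Ioo fun t ht => ht
    filter_upwards [ae_differentiableAt_of_lipschitzOnWith hab.le huL, h2] with t h3 h4 ht
    have hI : Icc (0 : ℝ) 1 ∈ 𝓝 t :=
      Filter.mem_of_superset (Icc_mem_nhds (h4 ht).1 (h4 ht).2) hsub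
    have h5 := chartNorm_deriv_le (L := L) x₀ (by
        filter_upwards [hI] with s hs
        rw [hγ t (hsub ht) s hs, abs_sub_comm, mul_comm])
      (hγc.continuousAt hI) (htsrc t ht) (h3 ht).hasDerivAt
    rw [chartForm_apply, chartMetric_self]
    exact pow_le_pow_left₀ (chartNorm_nonneg _ _ _) h5 2
  -- A competitor has the same endpoints, at distance `(b - a) L`, so its energy is at least the
  -- upper bound `hLu` for the energy of `u`.
  have hreg := hB.contDiffOn_and_geodesic_eq hab huL huU (by
    intro φ C hφ hφa hφb hφU
    refine hLu.trans ?_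
    have hvL : LipschitzOnWith ((C₂ * (2 * L)).toNNReal + C) (fun s => u s + φ s) (Icc a b) :=
      huL.add hφ
    refine le_integral_energy x₀ hab.le hball (K₁ := 2 * C₁) (by positivity) ?_ hvL hφU ?_
    · intro y hy z hz
      refine (hdist y hy z hz).trans ?_
      rw [mul_assoc]
      gcongr
      exact hC₁' _
    · simp only [hφa, hφb, add_zero]
      rw [← he, hsymm a (left_mem_Icc.2 hab.le), hsymm b (right_mem_Icc.2 hab.le),
        hγ _ (hsub (left_mem_Icc.2 hab.le)) _ (hsub (right_mem_Icc.2 hab.le)), abs_sub_comm,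
        abs_of_pos (by linarith)])
  exact ⟨a, b, hab, hsub, hnhds, htsrc, hreg⟩

end MetricGeodesic

end RadialConvexity

end

noncomputable section

namespace RadialConvexity

/-! ### Existence of minimizing geodesics. -/

section MinGeodesic

open MeasureTheory
open scoped ENNReal NNReal Topology

lemma derivWithin_eq_of_mem_nhdsWithin {F : Type*} [NormedAddCommGroup F] [NormedSpace ℝ F]
    (f : ℝ → F) {I J : Set ℝ} {t : ℝ} (hJI : J ⊆ I) (h : J ∈ 𝓝[I] t) :
    derivWithin f I t = derivWithin f J t := by
  refine derivWithin_congr_set ?_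
  filter_upwards [mem_nhdsWithin_iff_eventually.1 h] with s hs
  exact propext ⟨fun hsI => hs hsI, fun hsJ => hJI hsJ⟩

/-- On a curve from `x` to `y` of length less than `r`, the intermediate value theorem finds a point
at distance `δ` from `x`; the lengths of the two halves bound the two distances. -/
lemma exists_dist_eq_and_dist_add_le (E : Type*) [NormedAddCommGroup E] [NormedSpace ℝ E]
    {M : Type*} [MetricSpace M] [ChartedSpace E M]
    [RiemannianBundle (fun x : M => TangentSpace 𝓘(ℝ, E) x)] [IsRiemannianManifold 𝓘(ℝ, E) M]
    {x y : M} {δ : ℝ} (hδ : 0 ≤ δ) (hδxy : δ ≤ dist x y) {r : ℝ}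
    (hr : dist x y < r) : ∃ w, dist x w = δ ∧ δ + dist w y ≤ r := by
  have hr0 : 0 < r := dist_nonneg.trans_lt hr
  have hlt : riemannianEDist 𝓘(ℝ, E) x y < ENNReal.ofReal r := by
    rw [← IsRiemannianManifold.out (I := 𝓘(ℝ, E)), edist_dist]
    exact (ENNReal.ofReal_lt_ofReal_iff hr0).2 hr
  obtain ⟨γ, hγ0, hγ1, hγ, hlen⟩ := exists_lt_of_riemannianEDist_lt hlt
  have hc : ContinuousOn (fun t => dist x (γ t)) (Icc 0 1) :=
    (Continuous.dist continuous_const continuous_id).comp_continuousOn hγ.continuousOn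
  obtain ⟨t, ht, hxt⟩ := intermediate_value_Icc zero_le_one hc
    (show δ ∈ Icc (dist x (γ 0)) (dist x (γ 1)) by rw [hγ0, hγ1, dist_self]; exact ⟨hδ, hδxy⟩)
  refine ⟨γ t, hxt, ?_⟩
  have h1 : edist x (γ t) + edist (γ t) y ≤ ENNReal.ofReal r := by
    rw [IsRiemannianManifold.out (I := 𝓘(ℝ, E)) x, IsRiemannianManifold.out (I := 𝓘(ℝ, E)) _ y]
    refine le_trans (add_le_add
      (riemannianEDist_le_pathELength (hγ.mono (Icc_subset_Icc_right ht.2)) hγ0 rfl ht.1)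
      (riemannianEDist_le_pathELength (hγ.mono (Icc_subset_Icc_left ht.1)) rfl hγ1 ht.2)) ?_
    rw [pathELength_add ht.1 ht.2]
    exact hlen.le
  rw [edist_dist, edist_dist, ← ENNReal.ofReal_add dist_nonneg dist_nonneg,
    ENNReal.ofReal_le_ofReal_iff hr0.le] at h1
  simp only at hxt
  linarith

/-- A Riemannian manifold is Menger convex. -/
theorem exists_between (E : Type*) [NormedAddCommGroup E] [NormedSpace ℝ E] [FiniteDimensional ℝ E]
    {M : Type*} [MetricSpace M] [ChartedSpace E M]
    [RiemannianBundle (fun x : M => TangentSpace 𝓘(ℝ, E) x)] [IsRiemannianManifold 𝓘(ℝ, E) M]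
    {x y : M} (hxy : x ≠ y) :
    ∃ z, z ≠ x ∧ z ≠ y ∧ dist x z + dist z y = dist x y := by
  have : LocallyCompactSpace M := Manifold.locallyCompact_of_finiteDimensional 𝓘(ℝ, E)
  obtain ⟨r, hr, hcomp⟩ := Metric.exists_isCompact_closedBall x
  have hd : 0 < dist x y := dist_pos.2 hxy
  -- The bound `r` makes the sphere compact, so approximate between-points yield an exact one; the
  -- bound by half the distance keeps it away from `y`.
  set δ := min r (dist x y / 2) with hδ
  have hδ0 : 0 < δ := lt_min hr (by linarith)
  have hδd : δ ≤ dist x y / 2 := min_le_right _ _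
  have hS : IsCompact (Metric.sphere x δ) := hcomp.of_isClosed_subset Metric.isClosed_sphere
    (Metric.sphere_subset_closedBall.trans (Metric.closedBall_subset_closedBall (min_le_left _ _)))
  have hex : ∀ ε > 0, ∃ w ∈ Metric.sphere x δ, dist w y ≤ dist x y - δ + ε := by
    intro ε hε
    obtain ⟨w, hw, hwy⟩ := exists_dist_eq_and_dist_add_le E hδ0.le (by linarith : δ ≤ dist x y)
      (lt_add_of_pos_right (dist x y) hε)
    exact ⟨w, by rw [Metric.mem_sphere, dist_comm]; exact hw, by linarith⟩
  obtain ⟨w₀, hw₀, -⟩ := hex 1 one_pos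
  obtain ⟨z, hz, hmin⟩ := hS.exists_isMinOn ⟨w₀, hw₀⟩
    (f := fun w => dist w y) (by fun_prop)
  have hzy : dist z y ≤ dist x y - δ := by
    refine le_of_forall_pos_le_add fun ε hε => ?_
    obtain ⟨w, hw, hwy⟩ := hex ε hε
    exact (hmin hw).trans hwy
  rw [Metric.mem_sphere, dist_comm] at hz
  refine ⟨z, ?_, ?_, le_antisymm (by linarith) (dist_triangle _ _ _)⟩
  · rintro rfl
    rw [dist_self] at hz
    linarith
  · rintro rfl
    linarith

variable {E : Type*} [NormedAddCommGroup E] [NormedSpace ℝ E] [FiniteDimensional ℝ E]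
  {M : Type*} [MetricSpace M] [ChartedSpace E M] [IsManifold 𝓘(ℝ, E) ∞ M]
  [RiemannianBundle (fun x : M => TangentSpace 𝓘(ℝ, E) x)]
  [IsContMDiffRiemannianBundle 𝓘(ℝ, E) ∞ E (fun x : M => TangentSpace 𝓘(ℝ, E) x)]
  [IsRiemannianManifold 𝓘(ℝ, E) M]

set_option synthInstance.maxHeartbeats 400000
set_option synthInstance.maxSize 1000

/-- A curve of constant metric speed is a geodesic. -/
theorem isGeodesic_of_dist_eq {γ : ℝ → M} {L : ℝ} (hL0 : 0 ≤ L)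
    (hγ : ∀ s ∈ Icc (0 : ℝ) 1, ∀ t ∈ Icc (0 : ℝ) 1, dist (γ s) (γ t) = |s - t| * L) :
    IsGeodesic (E := E) γ where
  contMDiffOn := by
    intro t ht
    obtain ⟨a, b, -, -, hJ, -, hC2, -⟩ := exists_contDiffOn_and_geodesic_eq (E := E) hL0 hγ (γ t) ht
      (mem_extChartAt_source (γ t))
    have hγc : ContinuousWithinAt γ (Icc 0 1) t := by
      have : LipschitzOnWith L.toNNReal γ (Icc 0 1) := by
        apply LipschitzOnWith.of_dist_le_mul
        intro s hs t ht
        rw [hγ s hs t ht, Real.coe_toNNReal _ hL0, Real.dist_eq, mul_comm]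
      exact this.continuousOn t ht
    rw [contMDiffWithinAt_iff_target]
    refine ⟨hγc, ?_⟩
    rw [contMDiffWithinAt_iff_contDiffWithinAt]
    exact (hC2 t (mem_of_mem_nhdsWithin ht hJ)).mono_of_mem_nhdsWithin hJ
  geodesic_eq := by
    rintro x₀ u rfl t ht hsrc z
    obtain ⟨a, b, hab, hsub, hJ, hJsrc, hC2, hgeo⟩ :=
      exists_contDiffOn_and_geodesic_eq (E := E) hL0 hγ x₀ ht hsrc
    have htJ : t ∈ Icc a b := mem_of_mem_nhdsWithin ht hJ
    have h1 := derivWithin_eq_of_mem_nhdsWithin (fun s => extChartAt 𝓘(ℝ, E) x₀ (γ s)) hsub hJ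
    have h2 : derivWithin (derivWithin (fun s => extChartAt 𝓘(ℝ, E) x₀ (γ s)) (Icc 0 1))
        (Icc 0 1) t =
        derivWithin (derivWithin (fun s => extChartAt 𝓘(ℝ, E) x₀ (γ s)) (Icc a b)) (Icc a b) t := by
      rw [derivWithin_eq_of_mem_nhdsWithin _ hsub hJ]
      refine Filter.EventuallyEq.derivWithin_eq ?_ h1
      -- For the second derivative the first derivatives must agree near `t`, not only at `t`.
      have h3 : ∀ᶠ s in 𝓝[Icc 0 1] t, Icc a b ∈ 𝓝[Icc 0 1] s := eventually_eventually_nhdsWithin.2 hJ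
      filter_upwards [nhdsWithin_mono t hsub h3] with s hs
      exact derivWithin_eq_of_mem_nhdsWithin _ hsub hs
    rw [h2, h1, chartChristoffel_self x₀ ((extChartAt 𝓘(ℝ, E) x₀).map_source hsrc)]
    exact congr($(hgeo t htJ) z)

/-- A curve of constant metric speed is a length minimizing geodesic. -/
theorem isMinGeodesic_of_dist_eq {γ : ℝ → M} {x y : M} (h0 : γ 0 = x) (h1 : γ 1 = y)
    (hγ : ∀ s ∈ Icc (0 : ℝ) 1, ∀ t ∈ Icc (0 : ℝ) 1, dist (γ s) (γ t) = |s - t| * dist x y) :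
    IsMinGeodesic (E := E) γ x y where
  isGeodesic := isGeodesic_of_dist_eq dist_nonneg hγ
  source := h0
  target := h1
  length_eq := by
    have hgeo : IsGeodesic (E := E) γ := isGeodesic_of_dist_eq dist_nonneg hγ
    refine le_antisymm ?_ (riemannianEDist_le_pathELength
      (hgeo.contMDiffOn.of_le one_le_two) h0 h1 zero_le_one)
    rw [← IsRiemannianManifold.out (I := 𝓘(ℝ, E)), edist_dist,
      pathELength_eq_lintegral_mfderiv_Ioo]
    calc ∫⁻ t in Ioo (0 : ℝ) 1, ‖mfderiv 𝓘(ℝ, ℝ) 𝓘(ℝ, E) γ t (1 : ℝ)‖ₑ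
        ≤ ∫⁻ _ in Ioo (0 : ℝ) 1, ENNReal.ofReal (dist x y) := by
          refine setLIntegral_mono' measurableSet_Ioo fun t ht => ?_
          have hI : Icc (0 : ℝ) 1 ∈ 𝓝 t := Icc_mem_nhds ht.1 ht.2
          have htI : t ∈ Icc (0 : ℝ) 1 := Ioo_subset_Icc_self ht
          have hC : ContMDiffAt 𝓘(ℝ, ℝ) 𝓘(ℝ, E) 2 γ t := (hgeo.contMDiffOn t htI).contMDiffAt hI
          have hsrc := mem_extChartAt_source (I := 𝓘(ℝ, E)) (γ t)
          rw [← mfderivWithin_univ, enorm_mfderivWithin_eq_chartNorm (γ t)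
            (hC.mdifferentiableAt two_ne_zero).mdifferentiableWithinAt uniqueDiffWithinAt_univ hsrc,
            derivWithin_univ]
          apply ENNReal.ofReal_le_ofReal
          have hu : ContDiffAt ℝ 2 (fun s => extChartAt 𝓘(ℝ, E) (γ t) (γ s)) t := by
            rw [← contMDiffAt_iff_contDiffAt]
            exact contMDiffAt_extChartAt.comp t hC
          refine chartNorm_deriv_le (γ t) ?_ hC.continuousAt hsrc
            (hu.differentiableAt two_ne_zero).hasDerivAt
          filter_upwards [hI] with s hs
          rw [hγ t htI s hs, abs_sub_comm, mul_comm]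
      _ = ENNReal.ofReal (dist x y) := by simp

/-- **Hopf-Rinow**: in a complete Riemannian manifold any two points at finite distance are joined
by a length minimizing geodesic. -/
theorem exists_isMinGeodesic [CompleteSpace M] (x y : M) :
    ∃ γ : ℝ → M, IsMinGeodesic (E := E) γ x y := by
  obtain ⟨γ, h0, h1, hγ⟩ := exists_isometric_segment (fun _ _ h => exists_between E h) x y
  exact ⟨γ, isMinGeodesic_of_dist_eq h0 h1 hγ⟩

end MinGeodesic

/-! ### A geodesic is determined by its initial velocity. -/

section Uniqueness

open scoped Topology

variable {E : Type*} [NormedAddCommGroup E] [NormedSpace ℝ E] [FiniteDimensional ℝ E]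
  {M : Type*} [TopologicalSpace M] [ChartedSpace E M] [IsManifold 𝓘(ℝ, E) ∞ M]
  [RiemannianBundle (fun x : M => TangentSpace 𝓘(ℝ, E) x)]
  [IsContMDiffRiemannianBundle 𝓘(ℝ, E) ∞ E (fun x : M => TangentSpace 𝓘(ℝ, E) x)]

set_option synthInstance.maxHeartbeats 400000
set_option synthInstance.maxSize 1000

lemma IsGeodesic.hasDerivWithinAt_chart {γ : ℝ → M} (hγ : IsGeodesic (E := E) γ) (x₀ : M) {t : ℝ}
    (ht : t ∈ Icc (0 : ℝ) 1) (hsrc : γ t ∈ (extChartAt 𝓘(ℝ, E) x₀).source) :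
    let u := fun s => extChartAt 𝓘(ℝ, E) x₀ (γ s)
    HasDerivWithinAt u (derivWithin u (Icc 0 1) t) (Icc 0 1) t ∧
      HasDerivWithinAt (derivWithin u (Icc 0 1))
        (derivWithin (derivWithin u (Icc 0 1)) (Icc 0 1) t) (Icc 0 1) t ∧
      chartForm x₀ (u t) (derivWithin (derivWithin u (Icc 0 1)) (Icc 0 1) t)
        + christoffelForm (chartForm x₀) (u t) (derivWithin u (Icc 0 1) t) = 0 := by
  intro u
  have hud := uniqueDiffOn_Icc (zero_lt_one' ℝ)
  have hC2 : ContDiffWithinAt ℝ 2 u (Icc 0 1) t := by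
    rw [← contMDiffWithinAt_iff_contDiffWithinAt]
    exact (contMDiffAt_extChartAt' (by simpa using hsrc)).comp_contMDiffWithinAt t
      (hγ.contMDiffOn t ht)
  refine ⟨(hC2.differentiableWithinAt two_ne_zero).hasDerivWithinAt, ?_, ?_⟩
  · have h1 := hC2.fderivWithin_right hud (m := 1) (by norm_num) ht
    have h2 : ContDiffWithinAt ℝ 1 (fun s => fderivWithin ℝ u (Icc 0 1) s 1) (Icc 0 1) t :=
      h1.clm_apply contDiffWithinAt_const
    simp only [fderivWithin_derivWithin] at h2
    exact (h2.differentiableWithinAt one_ne_zero).hasDerivWithinAt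
  · ext z
    have h := hγ.geodesic_eq x₀ u rfl t ht hsrc z
    rwa [chartChristoffel_self x₀ ((extChartAt 𝓘(ℝ, E) x₀).map_source hsrc)] at h

/-- A geodesic is determined by its initial velocity. -/
theorem IsGeodesic.eqOn [T2Space M] {γ₁ γ₂ : ℝ → M} (h₁ : IsGeodesic (E := E) γ₁)
    (h₂ : IsGeodesic (E := E) γ₂) (h0 : γ₁ 0 = γ₂ 0)
    (hv : derivWithin (fun s => extChartAt 𝓘(ℝ, E) (γ₁ 0) (γ₁ s)) (Icc 0 1) 0 =
      derivWithin (fun s => extChartAt 𝓘(ℝ, E) (γ₁ 0) (γ₂ s)) (Icc 0 1) 0) :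
    ∀ t ∈ Icc (0 : ℝ) 1, γ₁ t = γ₂ t := by
  have hc₁ := h₁.contMDiffOn.continuousOn
  have hc₂ := h₂.contMDiffOn.continuousOn
  have hcl : IsClosed ({t | γ₁ t = γ₂ t} ∩ Icc 0 1) := by
    rw [inter_comm]
    exact (hc₁.prodMk hc₂).preimage_isClosed_of_isClosed isClosed_Icc isClosed_diagonal
  -- Continuous induction: the set of agreement is closed, and agreement on `[0,t]` extends to the
  -- right of `t`.
  refine hcl.Icc_subset_of_forall_mem_nhdsGT_of_Icc_subset h0 fun t ht hsub => ?_
  have htI : t ∈ Icc (0 : ℝ) 1 := ⟨ht.1, ht.2.le⟩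
  have heq : γ₁ t = γ₂ t := hsub ⟨ht.1, le_rfl⟩
  set e := extChartAt 𝓘(ℝ, E) (γ₁ t) with he
  set u₁ := fun s => e (γ₁ s) with hu₁
  set u₂ := fun s => e (γ₂ s) with hu₂
  have hsrc₁ : γ₁ t ∈ e.source := mem_extChartAt_source _
  have hsrc₂ : γ₂ t ∈ e.source := heq ▸ hsrc₁
  -- For `t > 0` the derivatives are computed from the left, on `[0,t]`, where the curves already
  -- agree; for `t = 0` this is the hypothesis.
  have hw : derivWithin u₁ (Icc 0 1) t = derivWithin u₂ (Icc 0 1) t := by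
    rcases ht.1.eq_or_lt with rfl | hpos
    · exact hv
    · have hud : UniqueDiffWithinAt ℝ (Icc 0 t) t :=
        uniqueDiffOn_Icc hpos t (right_mem_Icc.2 hpos.le)
      have hs : Icc 0 t ⊆ Icc (0 : ℝ) 1 := Icc_subset_Icc_right ht.2.le
      rw [← ((h₁.hasDerivWithinAt_chart _ htI hsrc₁).1.mono hs).derivWithin hud,
        ← ((h₂.hasDerivWithinAt_chart _ htI hsrc₂).1.mono hs).derivWithin hud]
      exact derivWithin_congr (fun s hs => congrArg e (hsub hs)) (congrArg e heq)
  have hN : ∀ᶠ s in 𝓝[Icc 0 1] t, γ₁ s ∈ e.source ∧ γ₂ s ∈ e.source :=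
    ((hc₁ t htI).eventually ((isOpen_extChartAt_source _).mem_nhds hsrc₁)).and
      ((hc₂ t htI).eventually ((isOpen_extChartAt_source _).mem_nhds hsrc₂))
  have hN' : {s | s ∈ Icc (0 : ℝ) 1 ∧ γ₁ s ∈ e.source ∧ γ₂ s ∈ e.source} ∈ 𝓝[≥] t := by
    have hle : 𝓝[≥] t ≤ 𝓝[Icc 0 1] t := nhdsWithin_le_of_mem (Icc_mem_nhdsGE_of_mem ht)
    exact hle (Filter.inter_mem self_mem_nhdsWithin hN)
  obtain ⟨t₁, ht₁, hsub₁⟩ := mem_nhdsGE_iff_exists_Icc_subset.1 hN'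
  have hs : Icc t t₁ ⊆ Icc (0 : ℝ) 1 := fun s hs => (hsub₁ hs).1
  have hd₁ := fun s (hs : s ∈ Icc t t₁) =>
    h₁.hasDerivWithinAt_chart (γ₁ t) (hsub₁ hs).1 (hsub₁ hs).2.1
  have hd₂ := fun s (hs : s ∈ Icc t t₁) =>
    h₂.hasDerivWithinAt_chart (γ₁ t) (hsub₁ hs).1 (hsub₁ hs).2.2
  obtain ⟨t₂, ht₂, hEq⟩ := (isMetricOn_chartForm (γ₁ t)).exists_eqOn_of_geodesic_eq ht₁
    (fun s h => (hd₁ s h).1.mono hs) (fun s h => (hd₁ s h).2.1.mono hs)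
    (fun s h => e.map_source (hsub₁ h).2.1) (fun s h => (hd₁ s h).2.2)
    (fun s h => (hd₂ s h).1.mono hs) (fun s h => (hd₂ s h).2.1.mono hs)
    (fun s h => e.map_source (hsub₁ h).2.2) (fun s h => (hd₂ s h).2.2)
    (congrArg e heq) hw
  filter_upwards [Ioc_mem_nhdsGT ht₂.1] with s h
  have hst₁ : s ∈ Icc t t₁ := ⟨h.1.le, h.2.trans ht₂.2⟩
  exact e.injOn (hsub₁ hst₁).2.1 (hsub₁ hst₁).2.2 (hEq s ⟨h.1.le, h.2⟩)

end Uniqueness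

end RadialConvexity

end

noncomputable section

namespace RadialConvexity

/-! ### Geodesic convexity and total `p`-convexity. -/

section Convexity

open scoped ENNReal

variable {E : Type*} [NormedAddCommGroup E] [NormedSpace ℝ E]

/-- Balls of infinite radius are clopen and nonempty, so connectedness makes each of them the whole
space. -/
lemma edist_ne_top_of_connectedSpace {X : Type*} [EMetricSpace X] [ConnectedSpace X] (x y : X) :
    edist x y ≠ ⊤ := by
  have h : IsClopen (Metric.eball x ⊤) := ⟨Metric.isClosed_eball_top, Metric.isOpen_eball⟩
  have hy : y ∈ Metric.eball x ⊤ := by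
    rw [h.eq_univ ⟨x, Metric.mem_eball_self ENNReal.zero_lt_top⟩]
    exact mem_univ y
  rw [edist_comm]
  exact (Metric.mem_eball.1 hy).ne

/-- **Hopf-Rinow** for connected complete Riemannian manifolds. -/
theorem exists_isMinGeodesic_of_connectedSpace [FiniteDimensional ℝ E]
    {M : Type*} [EMetricSpace M] [ChartedSpace E M] [IsManifold 𝓘(ℝ, E) ∞ M]
    [RiemannianBundle (fun x : M => TangentSpace 𝓘(ℝ, E) x)]
    [IsContMDiffRiemannianBundle 𝓘(ℝ, E) ∞ E (fun x : M => TangentSpace 𝓘(ℝ, E) x)]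
    [IsRiemannianManifold 𝓘(ℝ, E) M] [ConnectedSpace M] [CompleteSpace M] (x y : M) :
    ∃ γ : ℝ → M, IsMinGeodesic (E := E) γ x y :=
  letI : MetricSpace M := EMetricSpace.toMetricSpace edist_ne_top_of_connectedSpace
  exists_isMinGeodesic x y

variable {M : Type*} [TopologicalSpace M] [ChartedSpace E M]
  [RiemannianBundle (fun x : M => TangentSpace 𝓘(ℝ, E) x)]

lemma IsMinGeodesic.exists_initialVelocity {γ : ℝ → M} {p x : M}
    (h : IsMinGeodesic (E := E) γ p x) : ∃ v : TangentSpace 𝓘(ℝ, E) p,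
      (⟨γ 0, mfderivWithin 𝓘(ℝ, ℝ) 𝓘(ℝ, E) γ (Icc 0 1) 0 (1 : ℝ)⟩ : TangentBundle 𝓘(ℝ, E) M)
        = ⟨p, v⟩ := by
  obtain rfl := h.source
  exact ⟨_, rfl⟩

/-- The manifold derivative at `0` is by definition read in the chart at `γ 0`, the chart used on
the left. -/
lemma IsGeodesic.derivWithin_chart_zero {γ : ℝ → M} (h : IsGeodesic (E := E) γ) :
    derivWithin (fun s => extChartAt 𝓘(ℝ, E) (γ 0) (γ s)) (Icc 0 1) 0 =
      mfderivWithin 𝓘(ℝ, ℝ) 𝓘(ℝ, E) γ (Icc 0 1) 0 (1 : ℝ) := by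
  have hd : MDifferentiableWithinAt 𝓘(ℝ, ℝ) 𝓘(ℝ, E) γ (Icc 0 1) 0 :=
    (h.contMDiffOn 0 (left_mem_Icc.2 zero_le_one)).mdifferentiableWithinAt two_ne_zero
  have heq : derivWithin (fun s => extChartAt 𝓘(ℝ, E) (γ 0) (γ s)) (Icc 0 1) 0 =
      fderivWithin ℝ (writtenInExtChartAt 𝓘(ℝ, ℝ) 𝓘(ℝ, E) 0 γ)
        ((extChartAt 𝓘(ℝ, ℝ) (0 : ℝ)).symm ⁻¹' Icc 0 1 ∩ range 𝓘(ℝ, ℝ))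
        (extChartAt 𝓘(ℝ, ℝ) (0 : ℝ) 0) (1 : ℝ) := by
    rw [← fderivWithin_derivWithin]
    simp [writtenInExtChartAt, Function.comp_def, chartAt_self_eq]
  exact heq.trans congr($(hd.mfderivWithin.symm) (1 : ℝ))

/-- A geodesic is determined by its initial velocity. -/
theorem IsGeodesic.eqOn_of_velocity_eq [FiniteDimensional ℝ E] [IsManifold 𝓘(ℝ, E) ∞ M]
    [IsContMDiffRiemannianBundle 𝓘(ℝ, E) ∞ E (fun x : M => TangentSpace 𝓘(ℝ, E) x)] [T2Space M]
    {γ₁ γ₂ : ℝ → M} (h₁ : IsGeodesic (E := E) γ₁) (h₂ : IsGeodesic (E := E) γ₂)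
    (h : (⟨γ₁ 0, mfderivWithin 𝓘(ℝ, ℝ) 𝓘(ℝ, E) γ₁ (Icc 0 1) 0 (1 : ℝ)⟩ : TangentBundle 𝓘(ℝ, E) M)
      = ⟨γ₂ 0, mfderivWithin 𝓘(ℝ, ℝ) 𝓘(ℝ, E) γ₂ (Icc 0 1) 0 (1 : ℝ)⟩) :
    ∀ t ∈ Icc (0 : ℝ) 1, γ₁ t = γ₂ t := by
  have h0 : γ₁ 0 = γ₂ 0 := congrArg TotalSpace.proj h
  have hv : (mfderivWithin 𝓘(ℝ, ℝ) 𝓘(ℝ, E) γ₁ (Icc 0 1) 0 (1 : ℝ) : E) =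
      mfderivWithin 𝓘(ℝ, ℝ) 𝓘(ℝ, E) γ₂ (Icc 0 1) 0 (1 : ℝ) :=
    congrArg (fun v : TangentBundle 𝓘(ℝ, E) M => (v.2 : E)) h
  refine h₁.eqOn h₂ h0 ?_
  rw [h₁.derivWithin_chart_zero, h0, h₂.derivWithin_chart_zero]
  exact hv

lemma radialContraction_one {p : M} (η : DirectionFunction E p) (x : M) :
    radialContraction η 1 x = x :=
  (η.mem x).choose_spec.1.target

lemma geodesicallyConvex_of_forall_totallyConvexAt {A : Set M}
    (h : ∀ p ∈ A, TotallyConvexAt E p A) : GeodesicallyConvex E A := by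
  intro x hx y hy
  obtain ⟨-, η, hη⟩ := h x hx
  simpa only [radialContraction_one] using
    (hη 1 (right_mem_Ioc.2 one_pos)).2 x hx y hy

/-- The direction function is built from geodesics that stay in `A` whenever their endpoint does, so
all contractions of points of `A` remain in `A`. -/
theorem GeodesicallyConvex.totallyConvexAt [FiniteDimensional ℝ E] [IsManifold 𝓘(ℝ, E) ∞ M]
    [IsContMDiffRiemannianBundle 𝓘(ℝ, E) ∞ E (fun x : M => TangentSpace 𝓘(ℝ, E) x)] [T2Space M]
    (hM : ∀ x y : M, ∃ γ : ℝ → M, IsMinGeodesic (E := E) γ x y) {A : Set M}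
    (hA : GeodesicallyConvex E A) {p : M} (hp : p ∈ A) : TotallyConvexAt E p A := by
  have hγ : ∀ x : M, ∃ γ : ℝ → M, IsMinGeodesic (E := E) γ p x ∧
      (x ∈ A → ∀ t ∈ Icc (0 : ℝ) 1, γ t ∈ A) := by
    intro x
    by_cases hx : x ∈ A
    · obtain ⟨γ, h, hγA⟩ := hA p hp x hx
      exact ⟨γ, h, fun _ => hγA⟩
    · obtain ⟨γ, h⟩ := hM p x
      exact ⟨γ, h, fun hx' => absurd hx' hx⟩
  choose γ hmin hγA using hγ
  choose v hv using fun x => (hmin x).exists_initialVelocity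
  let η : DirectionFunction E p := ⟨v, fun x => ⟨γ x, hmin x, hv x⟩⟩
  have hη : ∀ x ∈ A, ∀ r ∈ Ioc (0 : ℝ) 1, radialContraction η r x ∈ A := by
    intro x hx r hr
    have hrI := Ioc_subset_Icc_self hr
    obtain ⟨h1, h2⟩ := (η.mem x).choose_spec
    -- The contraction follows some minimizing geodesic with velocity `η x`; equality of initial
    -- velocities identifies it with the chosen `γ x`.
    have heq : radialContraction η r x = γ x r :=
      h1.isGeodesic.eqOn_of_velocity_eq (hmin x).isGeodesic (h2.trans (hv x).symm) r hrI
    rw [heq]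
    exact hγA x hx r hrI
  exact ⟨⟨p, hp⟩, η, fun r hr => ⟨⟨p, hp⟩, fun x hx y hy => hA _ (hη x hx r hr) _ (hη y hy r hr)⟩⟩

end Convexity

end RadialConvexity

end

theorem mainTheorem8
    {E : Type*} [NormedAddCommGroup E] [NormedSpace ℝ E] [FiniteDimensional ℝ E]
    {M : Type*} [EMetricSpace M] [ChartedSpace E M] [IsManifold 𝓘(ℝ, E) ∞ M]
    [RiemannianBundle (fun x : M => TangentSpace 𝓘(ℝ, E) x)]
    [IsContMDiffRiemannianBundle 𝓘(ℝ, E) ∞ E (fun x : M => TangentSpace 𝓘(ℝ, E) x)]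
    [IsRiemannianManifold 𝓘(ℝ, E) M] [ConnectedSpace M] [CompleteSpace M]
    (A : Set M) (hA : 2 < A.encard) :
    RadialConvexity.GeodesicallyConvex E A ↔
      ∀ p ∈ A, RadialConvexity.TotallyConvexAt E p A :=
  ⟨fun h _ hp =>
    h.totallyConvexAt RadialConvexity.exists_isMinGeodesic_of_connectedSpace hp,
    RadialConvexity.geodesicallyConvex_of_forall_totallyConvexAt⟩
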